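/- Theorem. For a non-negative integer or half-integer $\lambda$, let $S^\lambda$ be the irreducible spin-$\lambda$ representation of $su(2)$ on $\mathbb{C}^{2\lambda+1}$, given in the standard basis $v_{-\lambda},v_{-\lambda+1},\dots,v_\lambda$ by $$S^\lambda(\sigma_3)v_\mu=\mu v_\mu,\qquad S^\lambda(\sigma_+)v_\mu=\sqrt{(\lambda-\mu)(\lambda+\mu+1)}\,v_{\mu+1},\qquad S^\lambda(\sigma_-)=S^\lambda(\sigma_+)^*,$$ $$S^\lambda(\sigma_1)=\tfrac12\big(S^\lambda(\sigma_+)+S^\lambda(\sigma_-)\big),\qquad S^\lambda(\sigma_2)=\tfrac1{2i}\big(S^\lambda(\sigma_+)-S^\lambda(\sigma_-)\big).$$ Let $N\ge 1$ be an integer and $L=\lfloor 1.045\,N^{4/7}\rfloor$. Let $m\ge1$ and let $\lambda_1,\dots,\lambda_m$ be non-negative integers or half-integers such that either $\lambda_{r+1}-\lambda_r=1$ for all $1\le r<m$, or $\lambda_{r+1}-\lambda_r=\frac12$ for all $1\le r<m$. Assume that $\lambda_m\le\frac12N$ and that $1\le i_*\le m$ is an index with $\lambda_{i_*}\le\frac12\sqrt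 N+1$. Let $n_1,\dots,n_m\ge0$ be integers with $n_i\ge n_{i+L}$ whenever $i\ge i_*$ and $i+L\le m$, and let $$S(\sigma_i)=\frac1N\big(n_1S^{\lambda_1}(\sigma_i)\oplus\cdots\oplus n_mS^{\lambda_m}(\sigma_i)\big),\qquad i=1,2,3,$$ where $n_rS^{\lambda_r}$ denotes the direct sum of $n_r$ copies of $S^{\lambda_r}$. Then there are pairwise commuting self-adjoint matrices $A_1',A_2',A_3'$ such that, in the operator norm, $$\|A_1'-S(\sigma_1)\|\le 6.286\,N^{-1/7},\qquad \|A_2'-S(\sigma_2)\|\le 6.286\,N^{-1/7},\qquad \|A_3'-S(\sigma_3)\|\le 1.083\,N^{-3/7},$$ and the matrices $A_1'$, $iA_2'$ and $A_3'$ have real entries in the standard basis. -/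

import Mathlib

open scoped Matrix.Norms.L2Operator

/-- The spin `λ = d / 2` of the irreducible representation of `su(2)` of dimension `d + 1`.
Spins (non-negative integers and half-integers) are encoded by the natural number `d = 2λ`. -/
noncomputable def spin (d : ℕ) : ℝ := (d : ℝ) / 2

/-- The weight `d_{λ,μ} = √((λ - μ)(λ + μ + 1))`, for `λ = spin d`. -/
noncomputable def spinWeight (d : ℕ) (μ : ℝ) : ℝ :=
  Real.sqrt ((spin d - μ) * (spin d + μ + 1))

/-- The `S^λ(σ₃)`-eigenvalue `-λ + k` of the `k`-th standard basis vector, for `λ = spin d`. -/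
noncomputable def magnetic (d : ℕ) (k : Fin (d + 1)) : ℝ := (k : ℝ) - spin d

/-- `S^λ(σ₃) = diag(-λ, -λ + 1, …, λ)`, for `λ = spin d`. -/
noncomputable def irrepThree (d : ℕ) : Matrix (Fin (d + 1)) (Fin (d + 1)) ℂ :=
  Matrix.diagonal fun k => ((magnetic d k : ℝ) : ℂ)

/-- The raising matrix `S^λ(σ₊)`, with `S^λ(σ₊) v_μ = d_{λ,μ} v_{μ+1}`, for `λ = spin d`. -/
noncomputable def irrepPlus (d : ℕ) : Matrix (Fin (d + 1)) (Fin (d + 1)) ℂ :=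
  Matrix.of fun j k =>
    if (j : ℕ) = (k : ℕ) + 1 then ((spinWeight d (magnetic d k) : ℝ) : ℂ) else 0

/-- The lowering matrix `S^λ(σ₋) = S^λ(σ₊)*`. -/
noncomputable def irrepMinus (d : ℕ) : Matrix (Fin (d + 1)) (Fin (d + 1)) ℂ :=
  (irrepPlus d).conjTranspose

/-- The irreducible spin-`λ` representation of `su(2)` (`λ = spin d`) on the spin matrices
`σ₁, σ₂, σ₃`, which are indexed here by `0, 1, 2`. Here `σ₊ = σ₁ + i σ₂` and `σ₋ = σ₁ - i σ₂`. -/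
noncomputable def irrep (d : ℕ) : Fin 3 → Matrix (Fin (d + 1)) (Fin (d + 1)) ℂ :=
  ![(1 / 2 : ℂ) • (irrepPlus d + irrepMinus d),
    (1 / (2 * Complex.I) : ℂ) • (irrepPlus d - irrepMinus d),
    irrepThree d]

/-- Index set of the standard basis of the space of `n₁S^{λ₁} ⊕ ⋯ ⊕ n_mS^{λ_m}`, with
`λ_r = spin (d r)`: a summand `r`, one of its `n r` copies, and a basis vector of that copy. -/
abbrev SumIndex {m : ℕ} (d n : Fin m → ℕ) : Type :=
  Σ p : (Σ r : Fin m, Fin (n r)), Fin (d p.1 + 1)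

/-- The scaled representation `(1/N)(n₁S^{λ₁} ⊕ ⋯ ⊕ n_mS^{λ_m})` on `σ₁, σ₂, σ₃`
(indexed by `0, 1, 2`), where `λ_r = spin (d r)`. -/
noncomputable def scaledSum (N : ℕ) {m : ℕ} (d n : Fin m → ℕ) (i : Fin 3) :
    Matrix (SumIndex d n) (SumIndex d n) ℂ :=
  (1 / (N : ℂ)) • Matrix.blockDiagonal' fun p : (Σ r : Fin m, Fin (n r)) => irrep (d p.1) i

/-- All entries of the matrix are real. -/
def IsRealMatrix {ι : Type} (M : Matrix ι ι ℂ) : Prop := ∀ p q, (M p q).im = 0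

/-- `L = ⌊1.045 N^{4/7}⌋`. -/
noncomputable def stepLength (N : ℕ) : ℕ := ⌊(1.045 : ℝ) * (N : ℝ) ^ ((4 : ℝ) / 7)⌋₊

open scoped Matrix ComplexOrder

/-! S(σ₊) is a shift along chains (one chain for each copy of a summand) times slowly varying
weights. By `exists_triple_of_normal` it suffices to find a real normal W near S(σ₊) that commutes
with a real self-adjoint A near S(σ₃). The weights are square roots of a quadratic function of spin
and position, so they change by O(√(L/N)) when both move by O(L). If the shift ran around loops of
bounded size instead of along the chains, giving each loop one weight would make it normal, and
giving each loop one position would make it commute with A.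

Such loops come from gradual exchange (Berg's technique). Over a window of ℓ sites, the basis
vectors of two strands are turned into one another by a quarter rotation, which costs the angle
π/(2ℓ) times the size of the weights. Each chain is cut into columns of length L. Chains r and r + L
are exchanged within a column, and neighbouring columns of one chain are exchanged with each other,
in such an order that the rotated paths wind around the corners where two chains and two columns
meet (`vertex_succ_partner_of_phase_eq`, `exists_path`). `exists_normal_commute_of_exchange` turns
this into matrices.

A chain of rank g (the number of chains r + qL, q ≥ 0, with the same copy index) uses about 4g
windows per column, and g ≤ N/L + 1, so ℓ is of order L²/(4N). The errors are of order N/L² and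
√(L/N) for W, and L/N for A. With L of order N^{4/7} these are N^{-1/7}, N^{-3/14} and N^{-3/7}. The
condition on multiplicities provides the lower chain of each exchange. Near the ends of the chains
and at small spins, where loops may be incomplete, the weights are O(√(L/N)) and are replaced by
zero. -/

set_option linter.unusedSectionVars false

/-! ### Linear algebra: weighted shifts in rotated bases. -/

section LinearAlgebra

variable {X : Type} [Fintype X] [DecidableEq X]

/-- The matrix of the permutation `e_x ↦ e_{σ x}`. -/
def shiftMatrix (σ : Equiv.Perm X) : Matrix X X ℂ :=
  Matrix.of fun y x => if y = σ x then 1 else 0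

/-- A real diagonal matrix, with complex entries. -/
def realDiag (a : X → ℝ) : Matrix X X ℂ := Matrix.diagonal fun x => (a x : ℂ)

/-- The matrix `e_x ↦ a x • e_x + b x • e_{τ x}`. -/
def planeMatrix (τ : Equiv.Perm X) (a b : X → ℝ) : Matrix X X ℂ :=
  realDiag a + shiftMatrix τ * realDiag b

lemma shiftMatrix_conjTranspose_mul (σ : Equiv.Perm X) :
    (shiftMatrix σ).conjTranspose * shiftMatrix σ = 1 := by
  ext y x
  simp [shiftMatrix, Matrix.mul_apply, Matrix.one_apply, eq_comm]

lemma realDiag_mul (a b : X → ℝ) : realDiag a * realDiag b = realDiag fun x => a x * b x := by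
  simp [realDiag]

lemma realDiag_conjTranspose (a : X → ℝ) : (realDiag a).conjTranspose = realDiag a := by
  ext y x
  by_cases h : x = y
  · subst h; simp [realDiag]
  · simp [realDiag, h, Ne.symm h]

lemma realDiag_mul_shiftMatrix (σ : Equiv.Perm X) (a : X → ℝ) :
    realDiag a * shiftMatrix σ = shiftMatrix σ * realDiag fun x => a (σ x) := by
  ext y x
  by_cases h : y = σ x
  · subst h; simp [realDiag, shiftMatrix]
  · simp [realDiag, shiftMatrix, h]

lemma realDiag_sub (a b : X → ℝ) : realDiag a - realDiag b = realDiag fun x => a x - b x := by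
  ext y x
  by_cases h : y = x
  · subst h; simp [realDiag]
  · simp [realDiag, h]

lemma norm_realDiag_le {a : X → ℝ} {ε : ℝ} (hε : 0 ≤ ε) (h : ∀ x, |a x| ≤ ε) :
    ‖realDiag a‖ ≤ ε := by
  rw [realDiag, Matrix.l2_opNorm_diagonal, pi_norm_le_iff_of_nonneg hε]
  intro x
  simpa using h x

lemma norm_le_of_conjTranspose_mul {M : Matrix X X ℂ} {a : X → ℝ} {δ : ℝ} (hδ : 0 ≤ δ)
    (h : M.conjTranspose * M = realDiag a) (ha : ∀ x, |a x| ≤ δ ^ 2) : ‖M‖ ≤ δ := by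
  have h1 := Matrix.l2_opNorm_conjTranspose_mul_self M
  rw [h] at h1
  have h2 := norm_realDiag_le (sq_nonneg δ) ha
  have := norm_nonneg M
  nlinarith

lemma norm_le_one_of_conjTranspose_mul {M : Matrix X X ℂ} (h : M.conjTranspose * M = 1) :
    ‖M‖ ≤ 1 := by
  refine norm_le_of_conjTranspose_mul (a := fun _ => 1) zero_le_one ?_ (by simp)
  rw [h]; ext y x; simp [realDiag]

lemma norm_shiftMatrix_le (σ : Equiv.Perm X) : ‖shiftMatrix σ‖ ≤ 1 :=
  norm_le_one_of_conjTranspose_mul (shiftMatrix_conjTranspose_mul σ)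

lemma planeMatrix_sub (τ : Equiv.Perm X) (a b a' b' : X → ℝ) :
    planeMatrix τ a' b' - planeMatrix τ a b
      = planeMatrix τ (fun x => a' x - a x) (fun x => b' x - b x) := by
  simp only [planeMatrix, ← realDiag_sub, mul_sub]
  abel

/-- The cross terms cancel because b changes sign under τ while a does not. This serves both for the
unitarity of the rotations and for the norm of the difference of two of them. -/
lemma planeMatrix_conjTranspose_mul {τ : Equiv.Perm X} (hτ : ∀ x, τ (τ x) = x) {a b : X → ℝ}
    (ha : ∀ x, a (τ x) = a x) (hb : ∀ x, b (τ x) = - b x) :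
    (planeMatrix τ a b).conjTranspose * planeMatrix τ a b
      = realDiag fun x => a x ^ 2 + b x ^ 2 := by
  have hT : (shiftMatrix τ).conjTranspose = shiftMatrix τ := by
    ext y x
    have : (x = τ y) ↔ (y = τ x) := by
      constructor
      · rintro rfl; exact (hτ y).symm
      · rintro rfl; exact (hτ x).symm
    by_cases h : y = τ x
    · simp [shiftMatrix, h, hτ]
    · simp [shiftMatrix, this, h]
  have hTT : shiftMatrix τ * shiftMatrix τ = 1 := by
    conv_lhs => rw [← hT]
    rw [← shiftMatrix_conjTranspose_mul τ, hT]
  have e1 : realDiag a * shiftMatrix τ = shiftMatrix τ * realDiag a := by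
    rw [realDiag_mul_shiftMatrix]; simp [ha]
  have e2 : realDiag b * shiftMatrix τ = - (shiftMatrix τ * realDiag b) := by
    rw [realDiag_mul_shiftMatrix]
    ext y x
    simp [realDiag, shiftMatrix, hb]
  have e3 : realDiag a * realDiag b = realDiag b * realDiag a := by
    simp [realDiag_mul, mul_comm]
  rw [planeMatrix, Matrix.conjTranspose_add, Matrix.conjTranspose_mul, hT, realDiag_conjTranspose,
    realDiag_conjTranspose]
  have : realDiag (fun x => a x ^ 2 + b x ^ 2) = realDiag a * realDiag a + realDiag b * realDiag b := by
    rw [realDiag_mul, realDiag_mul]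
    ext y x
    by_cases h : y = x
    · subst h; simp [realDiag, sq]
    · simp [realDiag, h]
  have e4 : realDiag a * (shiftMatrix τ * realDiag b)
      = shiftMatrix τ * (realDiag b * realDiag a) := by
    rw [← mul_assoc, e1, mul_assoc, e3]
  have e5 : realDiag b * shiftMatrix τ * realDiag a
      = - (shiftMatrix τ * (realDiag b * realDiag a)) := by
    rw [e2, neg_mul, mul_assoc]
  have e6 : realDiag b * shiftMatrix τ * (shiftMatrix τ * realDiag b)
      = realDiag b * realDiag b := by
    rw [mul_assoc, ← mul_assoc (shiftMatrix τ), hTT, one_mul]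
  rw [this, add_mul, mul_add, mul_add, e4, e5, e6]
  abel

lemma shiftMatrix_mulVec_single (σ : Equiv.Perm X) (x : X) :
    shiftMatrix σ *ᵥ (Pi.single x 1 : X → ℂ) = Pi.single (σ x) 1 := by
  ext y
  simp [shiftMatrix, Pi.single_apply]

lemma realDiag_mulVec_single (a : X → ℝ) (x : X) :
    realDiag a *ᵥ (Pi.single x 1 : X → ℂ) = (a x : ℂ) • Pi.single x 1 := by
  ext y
  by_cases h : y = x
  · subst h; simp [realDiag]
  · simp [realDiag, h]

lemma planeMatrix_mulVec_single (τ : Equiv.Perm X) (a b : X → ℝ) (x : X) :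
    planeMatrix τ a b *ᵥ (Pi.single x 1 : X → ℂ)
      = (a x : ℂ) • Pi.single x 1 + (b x : ℂ) • Pi.single (τ x) 1 := by
  rw [planeMatrix, Matrix.add_mulVec, realDiag_mulVec_single, ← Matrix.mulVec_mulVec,
    realDiag_mulVec_single, Matrix.mulVec_smul, shiftMatrix_mulVec_single]

/-- If the columns of a unitary matrix at which `w` is nonzero are supported in level sets of `w`,
then so are all the columns. -/
lemma eq_of_unitary_of_ne_zero {O : Matrix X X ℂ} (hO : O.conjTranspose * O = 1) {w : X → ℝ}
    (h : ∀ x y, w x ≠ 0 → O y x ≠ 0 → w y = w x) {x y : X} (hxy : O y x ≠ 0) : w y = w x := by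
  by_contra hne
  have hx : w x = 0 := by
    by_contra hx
    exact hne (h x y hx hxy)
  have hy : w y ≠ 0 := fun hy => hne (by rw [hx, hy])
  have hO' : O * O.conjTranspose = 1 := mul_eq_one_comm.mp hO
  have hcol : ∀ u, ∑ v, ‖O v u‖ ^ 2 = 1 := by
    intro u
    have := congrFun (congrFun hO u) u
    simp only [Matrix.mul_apply, Matrix.conjTranspose_apply, Matrix.one_apply_eq] at this
    have h2 : ((∑ v, ‖O v u‖ ^ 2 : ℝ) : ℂ) = 1 := by
      rw [← this]; push_cast
      refine Finset.sum_congr rfl fun v _ => ?_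
      exact (Complex.conj_mul' _).symm
    exact_mod_cast h2
  have hrow : ∀ v, ∑ u, ‖O v u‖ ^ 2 = 1 := by
    intro v
    have := congrFun (congrFun hO' v) v
    simp only [Matrix.mul_apply, Matrix.conjTranspose_apply, Matrix.one_apply_eq] at this
    have h2 : ((∑ u, ‖O v u‖ ^ 2 : ℝ) : ℂ) = 1 := by
      rw [← this]; push_cast
      refine Finset.sum_congr rfl fun u _ => ?_
      exact (Complex.mul_conj' _).symm
    exact_mod_cast h2
  -- The columns indexed by the level set Y of the nonzero value `w y` have all their mass in the
  -- rows of Y, so the Y × Y block has mass |Y|. The rows of Y have total mass |Y| too, and the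
  -- entry (y, x) outside the block would leave too little.
  let Y := Finset.univ.filter fun z => w z = w y
  have h1 : ∑ u ∈ Y, ∑ v ∈ Y, ‖O v u‖ ^ 2 = ∑ u ∈ Y, (1 : ℝ) := by
    refine Finset.sum_congr rfl fun u hu => ?_
    rw [← hcol u]
    refine Finset.sum_subset (Finset.subset_univ _) fun v _ hv => ?_
    have hu' : w u = w y := by simpa [Y] using hu
    by_contra h0
    apply hv
    simp only [Y, Finset.mem_filter, Finset.mem_univ, true_and]
    rw [← hu']
    exact h u v (by rwa [hu']) (by intro h3; simp [h3] at h0)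
  have h2 : ∑ v ∈ Y, ∑ u ∈ Y, ‖O v u‖ ^ 2 < ∑ v ∈ Y, (1 : ℝ) := by
    refine Finset.sum_lt_sum (fun v _ => ?_) ⟨y, by simp [Y], ?_⟩
    · rw [← hrow v]
      exact Finset.sum_le_sum_of_subset_of_nonneg (Finset.subset_univ _) fun _ _ _ => sq_nonneg _
    · rw [← hrow y]
      refine Finset.sum_lt_sum_of_subset (Finset.subset_univ _) (Finset.mem_univ x) ?_ ?_
        fun _ _ _ => sq_nonneg _
      · simpa [Y, hx] using hy.symm
      · exact pow_pos (norm_pos_iff.mpr hxy) 2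
  rw [Finset.sum_comm] at h2
  linarith

open scoped MatrixOrder in
/-- A Hermitian matrix between `-η` and `η` has norm at most `η`. -/
lemma norm_le_of_posSemidef {H : Matrix X X ℂ} {η : ℝ} (hH : H.IsHermitian) (hη : 0 ≤ η)
    (h1 : (realDiag (fun _ => η) - H).PosSemidef) (h2 : (H + realDiag fun _ => η).PosSemidef) :
    ‖H‖ ≤ η := by
  have hsa : IsSelfAdjoint H := hH
  have hal : algebraMap ℝ (Matrix X X ℂ) η = realDiag fun _ => η := by
    ext y x
    simp [realDiag, Matrix.algebraMap_matrix_apply, Matrix.diagonal_apply]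
  cases isEmpty_or_nonempty X with
  | inl hX =>
    rw [show H = 0 from Subsingleton.elim _ _, norm_zero]; exact hη
  | inr hX =>
    have hle : H ≤ algebraMap ℝ (Matrix X X ℂ) η := by
      rw [hal]; exact Matrix.le_iff.mpr h1
    have hge : algebraMap ℝ (Matrix X X ℂ) (-η) ≤ H := by
      rw [map_neg, hal]; exact Matrix.le_iff.mpr (by rwa [sub_neg_eq_add])
    rcases CStarAlgebra.norm_or_neg_norm_mem_spectrum hsa with h | h
    · exact (le_algebraMap_iff_spectrum_le hsa).mp hle _ h
    · have := (algebraMap_le_iff_le_spectrum hsa).mp hge _ h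
      linarith

lemma posSemidef_realDiag {f : X → ℝ} (hf : ∀ x, 0 ≤ f x) : (realDiag f).PosSemidef := by
  refine Matrix.PosSemidef.diagonal fun x => ?_
  simpa using hf x

lemma IsRealMatrix.add {M M' : Matrix X X ℂ} (h : IsRealMatrix M) (h' : IsRealMatrix M') :
    IsRealMatrix (M + M') := fun p q => by simp [h p q, h' p q]

lemma IsRealMatrix.mul {M M' : Matrix X X ℂ} (h : IsRealMatrix M) (h' : IsRealMatrix M') :
    IsRealMatrix (M * M') := fun p q => by
  simp [Matrix.mul_apply, h p, fun j => h' j q]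

lemma IsRealMatrix.conjTranspose {M : Matrix X X ℂ} (h : IsRealMatrix M) :
    IsRealMatrix M.conjTranspose := fun p q => by simp [h q p]

lemma isRealMatrix_realDiag (a : X → ℝ) : IsRealMatrix (realDiag a) := fun p q => by
  by_cases h : p = q
  · subst h; simp [realDiag]
  · simp [realDiag, h]

lemma isRealMatrix_shiftMatrix (σ : Equiv.Perm X) : IsRealMatrix (shiftMatrix σ) := fun p q => by
  by_cases h : p = σ q <;> simp [shiftMatrix, h]

lemma isRealMatrix_planeMatrix (τ : Equiv.Perm X) (a b : X → ℝ) :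
    IsRealMatrix (planeMatrix τ a b) :=
  (isRealMatrix_realDiag a).add ((isRealMatrix_shiftMatrix τ).mul (isRealMatrix_realDiag b))

/-- The exchange lemma: a weighted shift, rotated in the planes spanned by the pairs `e_x, e_{τ x}`
so that the rotated basis is moved along paths with constant weights, is close to a normal matrix
that commutes with a matrix close to a given diagonal one. -/
theorem exists_normal_commute_of_exchange (s τ : Equiv.Perm X) (hτ : ∀ x, τ (τ x) = x)
    {a b a' b' : X → ℝ} (ha : ∀ x, a (τ x) = a x) (hb : ∀ x, b (τ x) = - b x)
    (ha' : ∀ x, a' (τ x) = a' x) (hb' : ∀ x, b' (τ x) = - b' x)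
    (hab : ∀ x, a x ^ 2 + b x ^ 2 = 1) (hab' : ∀ x, a' x ^ 2 + b' x ^ 2 = 1)
    {w₀ w wm c lo hi μ : X → ℝ} (hwm : ∀ x, wm (τ x) = wm x)
    (hlo : ∀ x, lo (τ x) = lo x) (hhi : ∀ x, hi (τ x) = hi x)
    (hpath : ∀ x, w x ≠ 0 → ∃ (y : X) (ε : ℂ), w y = w x ∧ c y = c x ∧
      (a' x : ℂ) • Pi.single (s x) (1 : ℂ) + (b' x : ℂ) • Pi.single (s (τ x)) 1
        = ε • ((a y : ℂ) • Pi.single y (1 : ℂ) + (b y : ℂ) • Pi.single (τ y) 1))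
    {δ K ε₁ ε₂ η : ℝ} (hδ : 0 ≤ δ) (hK : 0 ≤ K) (hε₁ : 0 ≤ ε₁) (hε₂ : 0 ≤ ε₂)
    (hη : 0 ≤ η)
    (hrot : ∀ x, (a' x - a x) ^ 2 + (b' x - b x) ^ 2 ≤ δ ^ 2) (hwK : ∀ x, |wm x| ≤ K)
    (hw₁ : ∀ x, |w x - wm x| ≤ ε₁) (hw₂ : ∀ x, |wm x - w₀ x| ≤ ε₂)
    (hloc : ∀ x, lo x ≤ c x) (hchi : ∀ x, c x ≤ hi x) (hhiμ : ∀ x, hi x ≤ μ x + η)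
    (hμlo : ∀ x, μ x ≤ lo x + η) :
    ∃ W A : Matrix X X ℂ, W * Wᴴ = Wᴴ * W ∧ A.IsHermitian ∧ W * A = A * W ∧
      IsRealMatrix W ∧ IsRealMatrix A ∧
      ‖W - shiftMatrix s * realDiag w₀‖ ≤ ε₁ + δ * K + ε₂ ∧ ‖A - realDiag μ‖ ≤ η := by
  set R := planeMatrix τ a b with hR
  set R' := planeMatrix τ a' b' with hR'
  set U := shiftMatrix s with hU
  have hone : ∀ {f : X → ℝ}, (∀ x, f x = 1) → realDiag f = 1 := by
    intro f hf
    ext y x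
    simp [realDiag, hf]
  have hRR : Rᴴ * R = 1 := by
    rw [hR, planeMatrix_conjTranspose_mul hτ ha hb]; exact hone hab
  have hRR' : R'ᴴ * R' = 1 := by
    rw [hR', planeMatrix_conjTranspose_mul hτ ha' hb']; exact hone hab'
  have hUU : Uᴴ * U = 1 := shiftMatrix_conjTranspose_mul s
  have hRRt : R * Rᴴ = 1 := mul_eq_one_comm.mp hRR
  -- The shift read in rotated bases: R' at the start, and R, whose angles are one step behind, at
  -- the end. Along a path, one application of U makes up for this step.
  set O := Rᴴ * (U * R') with hO
  have hOO : Oᴴ * O = 1 := by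
    rw [hO, Matrix.conjTranspose_mul, Matrix.conjTranspose_mul, Matrix.conjTranspose_conjTranspose]
    calc R'ᴴ * Uᴴ * R * (Rᴴ * (U * R')) = R'ᴴ * Uᴴ * (R * Rᴴ) * (U * R') := by
          simp only [mul_assoc]
      _ = R'ᴴ * (Uᴴ * U) * R' := by rw [hRRt]; simp only [mul_assoc, mul_one]
      _ = 1 := by rw [hUU, mul_one, hRR']
  have hcol : ∀ x, w x ≠ 0 → ∃ (y : X) (ε : ℂ), w y = w x ∧ c y = c x ∧
      O *ᵥ Pi.single x 1 = ε • Pi.single y 1 := by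
    intro x hx
    obtain ⟨y, ε, h1, h2, h3⟩ := hpath x hx
    refine ⟨y, ε, h1, h2, ?_⟩
    rw [hO, ← Matrix.mulVec_mulVec, ← Matrix.mulVec_mulVec, hR', planeMatrix_mulVec_single,
      Matrix.mulVec_add, Matrix.mulVec_smul, Matrix.mulVec_smul, hU, shiftMatrix_mulVec_single,
      shiftMatrix_mulVec_single, h3, ← planeMatrix_mulVec_single, Matrix.mulVec_smul,
      ← hR, Matrix.mulVec_mulVec, hRR, Matrix.one_mulVec]
  have hent : ∀ x y, w x ≠ 0 → O y x ≠ 0 → w y = w x ∧ c y = c x := by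
    intro x y hx hyx
    obtain ⟨z, ε, h1, h2, h3⟩ := hcol x hx
    have h4 := congrFun h3 y
    by_cases hyz : y = z
    · subst hyz; exact ⟨h1, h2⟩
    · simp [hyz] at h4
      exact absurd h4 hyx
  -- The paths control only the columns with w ≠ 0; unitarity takes care of the others.
  have hOw : realDiag w * O = O * realDiag w := by
    ext y x
    simp only [realDiag, Matrix.diagonal_mul, Matrix.mul_diagonal]
    by_cases h : O y x = 0
    · simp [h]
    · rw [eq_of_unitary_of_ne_zero hOO (fun x y hx hy => (hent x y hx hy).1) h, mul_comm]
  -- Where w = 0, O need not preserve c, so only the product of O with w commutes with c.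
  have hOc : O * realDiag w * realDiag c = realDiag c * (O * realDiag w) := by
    ext y x
    simp only [realDiag, Matrix.diagonal_mul, Matrix.mul_diagonal]
    by_cases h : O y x = 0
    · simp [h]
    · by_cases hx : w x = 0
      · simp [hx]
      · rw [(hent x y hx h).2]; ring
  have hOOt : O * Oᴴ = 1 := mul_eq_one_comm.mp hOO
  have hOw' : Oᴴ * realDiag w = realDiag w * Oᴴ := by
    have := congrArg Matrix.conjTranspose hOw
    rwa [Matrix.conjTranspose_mul (realDiag w) O, Matrix.conjTranspose_mul O,
      realDiag_conjTranspose] at this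
  set P := O * realDiag w with hP
  have hPP : P * Pᴴ = Pᴴ * P := by
    rw [hP, Matrix.conjTranspose_mul, realDiag_conjTranspose]
    calc O * realDiag w * (realDiag w * Oᴴ) = realDiag w * O * (Oᴴ * realDiag w) := by
          rw [hOw, hOw']
      _ = realDiag w * (O * Oᴴ) * realDiag w := by simp only [mul_assoc]
      _ = realDiag w * (Oᴴ * O) * realDiag w := by rw [hOOt, hOO]
      _ = realDiag w * Oᴴ * (O * realDiag w) := by simp only [mul_assoc]
  have hconj : ∀ M M' : Matrix X X ℂ, R * M * Rᴴ * (R * M' * Rᴴ) = R * (M * M') * Rᴴ := by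
    intro M M'
    calc R * M * Rᴴ * (R * M' * Rᴴ) = R * M * (Rᴴ * R) * M' * Rᴴ := by simp only [mul_assoc]
      _ = R * (M * M') * Rᴴ := by rw [hRR]; simp only [mul_assoc, mul_one]
  have hconjT : ∀ M : Matrix X X ℂ, (R * M * Rᴴ)ᴴ = R * Mᴴ * Rᴴ := by
    intro M
    simp [Matrix.conjTranspose_mul, mul_assoc]
  have hnR : ‖R‖ ≤ 1 := norm_le_one_of_conjTranspose_mul hRR
  have hnR' : ‖R'‖ ≤ 1 := norm_le_one_of_conjTranspose_mul hRR'
  have hnRt : ‖Rᴴ‖ ≤ 1 := by rw [Matrix.l2_opNorm_conjTranspose]; exact hnR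
  have hnU : ‖U‖ ≤ 1 := norm_shiftMatrix_le s
  have hmulR : ∀ M : Matrix X X ℂ, ‖M * R‖ ≤ ‖M‖ := fun M =>
    (Matrix.l2_opNorm_mul _ _).trans (mul_le_of_le_one_right (norm_nonneg _) hnR)
  have hRt : ∀ M : Matrix X X ℂ, ‖M * Rᴴ‖ ≤ ‖M‖ := fun M =>
    (Matrix.l2_opNorm_mul _ _).trans (mul_le_of_le_one_right (norm_nonneg _) hnRt)
  have hRm : ∀ M : Matrix X X ℂ, ‖R * M‖ ≤ ‖M‖ := fun M =>
    (Matrix.l2_opNorm_mul _ _).trans (mul_le_of_le_one_left (norm_nonneg _) hnR)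
  have hRm' : ∀ M : Matrix X X ℂ, ‖R' * M‖ ≤ ‖M‖ := fun M =>
    (Matrix.l2_opNorm_mul _ _).trans (mul_le_of_le_one_left (norm_nonneg _) hnR')
  have hUm : ∀ M : Matrix X X ℂ, ‖U * M‖ ≤ ‖M‖ := fun M =>
    (Matrix.l2_opNorm_mul _ _).trans (mul_le_of_le_one_left (norm_nonneg _) hnU)
  have hplane : ∀ {f : X → ℝ}, (∀ x, f (τ x) = f x) → realDiag f * R = R * realDiag f := by
    intro f hf
    rw [hR, planeMatrix, mul_add, add_mul, ← mul_assoc, realDiag_mul_shiftMatrix, mul_assoc,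
      mul_assoc, realDiag_mul, realDiag_mul, realDiag_mul, realDiag_mul]
    simp only [hf, mul_comm]
  refine ⟨R * P * Rᴴ, R * realDiag c * Rᴴ, ?_, ?_, ?_, ?_, ?_, ?_, ?_⟩
  · rw [hconjT, hconj, hconj, hPP]
  · rw [Matrix.IsHermitian, hconjT, realDiag_conjTranspose]
  · rw [hconj, hconj, hOc]
  · have := isRealMatrix_planeMatrix τ a b
    exact (this.mul (((this.conjTranspose.mul ((isRealMatrix_shiftMatrix s).mul
      (isRealMatrix_planeMatrix τ a' b')))).mul (isRealMatrix_realDiag w))).mul this.conjTranspose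
  · have := isRealMatrix_planeMatrix τ a b
    exact (this.mul (isRealMatrix_realDiag c)).mul this.conjTranspose
  -- Telescoping through `wm`, which is constant on the exchanged pairs and hence commutes with R.
  · have key : R * P * Rᴴ - U * realDiag w₀
        = U * (R' * (realDiag w - realDiag wm) + (R' - R) * realDiag wm
          + (realDiag wm - realDiag w₀) * R) * Rᴴ := by
      have e1 : R * P = U * R' * realDiag w := by
        rw [hP, hO]
        calc R * (Rᴴ * (U * R') * realDiag w) = (R * Rᴴ) * (U * R') * realDiag w := by
              simp only [mul_assoc]
          _ = _ := by rw [hRRt, one_mul]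
      have e2 : U * realDiag w₀ = U * realDiag w₀ * R * Rᴴ := by
        rw [mul_assoc _ R, hRRt, mul_one]
      rw [e1]
      nth_rewrite 1 [e2]
      rw [← sub_mul]
      congr 1
      rw [mul_sub, sub_mul, sub_mul, hplane hwm]
      simp only [mul_add, mul_sub, mul_assoc]
      abel
    rw [key]
    refine (hRt _).trans ((hUm _).trans ((norm_add₃_le).trans ?_))
    gcongr
    · refine (hRm' _).trans ?_
      rw [realDiag_sub]
      exact norm_realDiag_le hε₁ hw₁
    · refine (Matrix.l2_opNorm_mul _ _).trans ?_
      refine mul_le_mul ?_ (norm_realDiag_le hK hwK) (norm_nonneg _) hδ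
      rw [hR, hR', planeMatrix_sub]
      refine norm_le_of_conjTranspose_mul hδ
        (planeMatrix_conjTranspose_mul hτ (by simp [ha, ha']) fun x => by rw [hb, hb']; ring) ?_
      intro x
      rw [abs_of_nonneg (by positivity)]
      exact hrot x
    · refine (hmulR _).trans ?_
      rw [realDiag_sub]
      exact norm_realDiag_le hε₂ hw₂
  -- The bounds `lo` and `hi` are constant on exchanged pairs and survive the conjugation by R, so
  -- they enclose A as quadratic forms.
  · have hfix : ∀ {f : X → ℝ}, (∀ x, f (τ x) = f x) → R * realDiag f * Rᴴ = realDiag f := by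
      intro f hf
      rw [← hplane hf, mul_assoc, hRRt, mul_one]
    have hherm : ∀ f : X → ℝ, (realDiag f).IsHermitian := realDiag_conjTranspose
    have hA : (R * realDiag c * Rᴴ).IsHermitian := by
      rw [Matrix.IsHermitian, hconjT, realDiag_conjTranspose]
    refine norm_le_of_posSemidef (hA.sub (hherm μ)) hη ?_ ?_
    · have key : realDiag (fun _ => η) - (R * realDiag c * Rᴴ - realDiag μ)
          = R * (realDiag fun x => hi x - c x) * Rᴴ
            + realDiag fun x => η - (hi x - μ x) := by
        rw [← realDiag_sub, ← realDiag_sub (fun _ => η), ← realDiag_sub hi μ, mul_sub, sub_mul,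
          hfix hhi]
        abel
      rw [key]
      exact ((posSemidef_realDiag fun x => by linarith [hchi x]).mul_mul_conjTranspose_same R).add
        (posSemidef_realDiag fun x => by linarith [hhiμ x])
    · have key : R * realDiag c * Rᴴ - realDiag μ + realDiag (fun _ => η)
          = R * (realDiag fun x => c x - lo x) * Rᴴ
            + realDiag fun x => η - (μ x - lo x) := by
        rw [← realDiag_sub, ← realDiag_sub (fun _ => η), ← realDiag_sub μ lo, mul_sub, sub_mul,
          hfix hlo]
        abel
      rw [key]
      exact ((posSemidef_realDiag fun x => by linarith [hloc x]).mul_mul_conjTranspose_same R).add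
        (posSemidef_realDiag fun x => by linarith [hμlo x])

/-- The real and imaginary parts of a normal matrix near `S` are near those of `S`. -/
lemma exists_triple_of_normal {W A S Z B₁ B₂ : Matrix X X ℂ} (hW : W * Wᴴ = Wᴴ * W)
    (hA : A.IsHermitian) (hWA : W * A = A * W) (hWr : IsRealMatrix W) (hAr : IsRealMatrix A)
    (hB₁ : B₁ = (1 / 2 : ℂ) • (S + Sᴴ)) (hB₂ : B₂ = (1 / (2 * Complex.I) : ℂ) • (S - Sᴴ))
    {ε η : ℝ} (hε : ‖W - S‖ ≤ ε) (hη : ‖A - Z‖ ≤ η) :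
    ∃ A₁ A₂ A₃ : Matrix X X ℂ,
      A₁.IsHermitian ∧ A₂.IsHermitian ∧ A₃.IsHermitian ∧
      Commute A₁ A₂ ∧ Commute A₁ A₃ ∧ Commute A₂ A₃ ∧
      ‖A₁ - B₁‖ ≤ ε ∧ ‖A₂ - B₂‖ ≤ ε ∧ ‖A₃ - Z‖ ≤ η ∧
      IsRealMatrix A₁ ∧ IsRealMatrix (Complex.I • A₂) ∧ IsRealMatrix A₃ := by
  have hWA' : Commute Wᴴ A := by
    have := congrArg Matrix.conjTranspose hWA
    rw [Matrix.conjTranspose_mul, Matrix.conjTranspose_mul, hA.eq] at this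
    exact this.symm
  have hWA0 : Commute W A := hWA
  have hWW : Commute W Wᴴ := hW
  have hT : ‖(W - S)ᴴ‖ ≤ ε := by rw [Matrix.l2_opNorm_conjTranspose]; exact hε
  have hn : ∀ (z : ℂ) (M : Matrix X X ℂ), ‖z‖ = 1 / 2 → ‖M‖ ≤ 2 * ε → ‖z • M‖ ≤ ε := by
    intro z M hz hM
    rw [norm_smul, hz]; linarith
  refine ⟨(1 / 2 : ℂ) • (W + Wᴴ), (1 / (2 * Complex.I) : ℂ) • (W - Wᴴ), A, ?_, ?_, hA, ?_, ?_, ?_,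
    ?_, ?_, hη, ?_, ?_, hAr⟩
  · rw [Matrix.IsHermitian, Matrix.conjTranspose_smul]
    simp [add_comm]
  · rw [Matrix.IsHermitian, Matrix.conjTranspose_smul]
    simp only [Matrix.conjTranspose_sub, Matrix.conjTranspose_conjTranspose]
    rw [← neg_sub W, smul_neg, ← neg_smul]
    congr 1
    simp
  · refine Commute.smul_left (Commute.smul_right ?_ _) _
    exact ((Commute.refl W).sub_right hWW).add_left (hWW.symm.sub_right (Commute.refl _))
  · exact Commute.smul_left (hWA0.add_left hWA') _
  · exact Commute.smul_left (hWA0.sub_left hWA') _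
  · rw [hB₁, ← smul_sub]
    refine hn _ _ (by simp) ?_
    have : W + Wᴴ - (S + Sᴴ) = (W - S) + (W - S)ᴴ := by
      rw [Matrix.conjTranspose_sub]; abel
    rw [this]
    exact (norm_add_le _ _).trans (by linarith)
  · rw [hB₂, ← smul_sub]
    refine hn _ _ (by simp) ?_
    have : W - Wᴴ - (S - Sᴴ) = (W - S) - (W - S)ᴴ := by
      rw [Matrix.conjTranspose_sub]; abel
    rw [this]
    exact (norm_sub_le _ _).trans (by linarith)
  · intro p q
    have h1 := hWr p q
    have h2 := hWr q p
    simp [h1, h2]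
  · intro p q
    have h1 := hWr p q
    have h2 := hWr q p
    rw [smul_smul]
    have : Complex.I * (1 / (2 * Complex.I)) = 1 / 2 := by
      field_simp
    rw [this]
    simp [h1, h2]

end LinearAlgebra

/-! ### Combinatorics: windows, partners, and paths around corners. -/

/-- The combinatorics of the exchanges. The sites `(r, a, y)` form chains `(r, a)`; a chain is cut
into columns of length `L`, and the columns are cut into windows of length `ℓ`. In every column, a
chain has `4 g - 3` typed windows. -/
structure ExchangeData where
  L : ℤ
  ℓ : ℤ
  g : ℤ → ℤ → ℤ
  Site : ℤ × ℤ × ℤ → Prop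
  Good : ℤ × ℤ × ℤ → Prop
  window_pos : 0 < ℓ
  g_pos : ∀ {r a y}, Site (r, a, y) → 1 ≤ g r a
  fits : ∀ {r a y}, Site (r, a, y) → 4 * g r a * ℓ ≤ L
  g_step : ∀ {r a y y'}, Site (r, a, y) → Site (r + L, a, y') → g r a = g (r + L) a + 1
  site_of_good : ∀ {r a k y}, Good (r, a, k) → (k - 1) * L ≤ y → y ≤ (k + 1) * L →
    Site (r, a, y) ∧ Site (r - L, a, y)

namespace ExchangeData

variable (D : ExchangeData)

/-- The index of the window of a site in its column. -/
def win (y : ℤ) : ℤ := (y % D.L) / D.ℓ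

/-- The place of a site in its window. -/
def phase (y : ℤ) : ℤ := (y % D.L) % D.ℓ

/-- The type of a site: its window is exchanged with the chain below (`0`), the next column (`1`),
the chain above (`2`), the previous column (`3`), or it is not exchanged (`4`). -/
def kind (p : ℤ × ℤ × ℤ) : ℤ :=
  if D.win p.2.2 < 4 * D.g p.1 p.2.1 - 3 then D.win p.2.2 % 4 else 4

/-- The site with which a site is exchanged. -/
def partner (p : ℤ × ℤ × ℤ) : ℤ × ℤ × ℤ :=
  if D.kind p = 0 then (p.1 - D.L, p.2.1, p.2.2 + 2 * D.ℓ)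
  else if D.kind p = 1 then (p.1, p.2.1, p.2.2 + (D.L + 2 * D.ℓ))
  else if D.kind p = 2 then (p.1 + D.L, p.2.1, p.2.2 - 2 * D.ℓ)
  else if D.kind p = 3 then (p.1, p.2.1, p.2.2 - (D.L + 2 * D.ℓ))
  else p

/-- The corner of a box, given by a chain and a column, around which the path through a site
runs. -/
def vertex (p : ℤ × ℤ × ℤ) : ℤ × ℤ × ℤ :=
  (p.1 + (if D.kind p = 2 ∨ D.kind p = 3 then D.L else 0), p.2.1,
    p.2.2 / D.L + if D.kind p = 1 ∨ D.kind p = 2 ∨ D.kind p = 4 then 1 else 0)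

/-- The next site of a chain. -/
def succ (p : ℤ × ℤ × ℤ) : ℤ × ℤ × ℤ := (p.1, p.2.1, p.2.2 + 1)

/-- The site is exchanged with its partner. -/
def Exchanged (p : ℤ × ℤ × ℤ) : Prop := D.kind p ≠ 4 ∧ D.Site p ∧ D.Site (D.partner p)

lemma ediv_emod_add {y e L : ℤ} (h0 : 0 ≤ y % L + e) (h1 : y % L + e < L) :
    (y + e) / L = y / L ∧ (y + e) % L = y % L + e := by
  have h := Int.mul_ediv_add_emod y L
  have : y + e = (y % L + e) + L * (y / L) := by linarith
  have hL : L ≠ 0 := by omega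
  rw [this, Int.add_mul_ediv_left _ _ hL, Int.add_mul_emod_self_left, Int.ediv_eq_zero_of_lt h0 h1,
    Int.emod_eq_of_lt h0 h1]
  simp

variable {D}

lemma kind_cases (p : ℤ × ℤ × ℤ) :
    D.kind p = 0 ∨ D.kind p = 1 ∨ D.kind p = 2 ∨ D.kind p = 3 ∨ D.kind p = 4 := by
  unfold kind; split <;> omega

lemma length_pos {r a y : ℤ} (h : D.Site (r, a, y)) : 0 < D.L := by
  have h1 := D.g_pos h
  have h2 := D.fits h
  have h3 := D.window_pos
  nlinarith [mul_pos (show 0 < D.g r a by omega) h3]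

lemma win_nonneg {y : ℤ} (hL : 0 < D.L) : 0 ≤ D.win y :=
  Int.ediv_nonneg (Int.emod_nonneg _ hL.ne') D.window_pos.le

lemma phase_nonneg (y : ℤ) : 0 ≤ D.phase y := Int.emod_nonneg _ D.window_pos.ne'

lemma phase_lt (y : ℤ) : D.phase y < D.ℓ := Int.emod_lt_of_pos _ D.window_pos

lemma emod_eq (y : ℤ) : y % D.L = D.win y * D.ℓ + D.phase y := by
  have := Int.mul_ediv_add_emod (y % D.L) D.ℓ
  unfold win phase; linarith [mul_comm ((y % D.L) / D.ℓ) D.ℓ]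

/-- A move of `e` inside the column, to window `i` and place `j`. -/
lemma move {y e i j : ℤ} (he : y % D.L + e = i * D.ℓ + j) (hi : 0 ≤ i) (hj0 : 0 ≤ j) (hj : j < D.ℓ)
    (hL : (i + 1) * D.ℓ ≤ D.L) :
    (y + e) / D.L = y / D.L ∧ D.win (y + e) = i ∧ D.phase (y + e) = j := by
  have h3 := D.window_pos
  have h1 : 0 ≤ y % D.L + e := by rw [he]; positivity
  have h2 : y % D.L + e < D.L := by rw [he]; linarith
  obtain ⟨h4, h5⟩ := ediv_emod_add h1 h2
  refine ⟨h4, ?_, ?_⟩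
  · rw [win, h5, he, add_comm, Int.add_mul_ediv_right _ _ h3.ne', Int.ediv_eq_zero_of_lt hj0 hj,
      zero_add]
  · rw [phase, h5, he, add_comm, Int.add_mul_emod_self_right, Int.emod_eq_of_lt hj0 hj]

lemma win_lt_of_kind_ne {r a y : ℤ} (h : D.kind (r, a, y) ≠ 4) :
    D.win y < 4 * D.g r a - 3 ∧ D.kind (r, a, y) = D.win y % 4 := by
  unfold kind at h ⊢
  split
  · rename_i h1; exact ⟨h1, rfl⟩
  · rename_i h1; simp [h1] at h

lemma fits_of_le {r a y i : ℤ} (h : D.Site (r, a, y)) (hi : i + 1 ≤ 4 * D.g r a) :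
    (i + 1) * D.ℓ ≤ D.L :=
  (mul_le_mul_of_nonneg_right hi D.window_pos.le).trans (D.fits h)

lemma kind_eq_of_win {r a y : ℤ} (h : D.win y < 4 * D.g r a - 3) :
    D.kind (r, a, y) = D.win y % 4 := by
  unfold kind; simp [h]

lemma kind_eq_four_of_win {r a y : ℤ} (h : 4 * D.g r a - 3 ≤ D.win y) :
    D.kind (r, a, y) = 4 := by
  unfold kind; simp [not_lt.mpr h]

/-- A window of type 0 has index at most 4g - 4. The chain below has rank g + 1, so the window two
further on is still typed there. This is why the number of typed windows grows by four from a chain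
to the one below. -/
lemma partner_of_kind_zero {r a y : ℤ} (h : D.kind (r, a, y) = 0) (hs : D.Site (r, a, y))
    (hp : D.Site (r - D.L, a, y + 2 * D.ℓ)) :
    D.kind (r - D.L, a, y + 2 * D.ℓ) = 2 ∧ (y + 2 * D.ℓ) / D.L = y / D.L ∧
      D.win (y + 2 * D.ℓ) = D.win y + 2 ∧ D.phase (y + 2 * D.ℓ) = D.phase y := by
  obtain ⟨h1, h2⟩ := win_lt_of_kind_ne (D := D) (r := r) (a := a) (y := y) (by omega)
  have hL := length_pos hs
  have hw := win_nonneg (D := D) (y := y) hL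
  have hg := D.g_step hp (y' := y) (by rwa [sub_add_cancel])
  rw [sub_add_cancel] at hg
  obtain ⟨h3, h4, h5⟩ := move (D := D) (y := y) (e := 2 * D.ℓ) (i := D.win y + 2)
    (j := D.phase y) (by rw [emod_eq]; ring) (by omega) (phase_nonneg y) (phase_lt y)
    (fits_of_le hs (by omega))
  refine ⟨?_, h3, h4, h5⟩
  rw [kind_eq_of_win (by omega), h4]
  omega

lemma partner_of_kind_two {r a y : ℤ} (h : D.kind (r, a, y) = 2) (hs : D.Site (r, a, y))
    (hp : D.Site (r + D.L, a, y - 2 * D.ℓ)) :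
    D.kind (r + D.L, a, y - 2 * D.ℓ) = 0 ∧ (y - 2 * D.ℓ) / D.L = y / D.L ∧
      D.win (y - 2 * D.ℓ) = D.win y - 2 ∧ D.phase (y - 2 * D.ℓ) = D.phase y := by
  obtain ⟨h1, h2⟩ := win_lt_of_kind_ne (D := D) (r := r) (a := a) (y := y) (by omega)
  have hL := length_pos hs
  have hw := win_nonneg (D := D) (y := y) hL
  have hg := D.g_step hs hp
  obtain ⟨h3, h4, h5⟩ := move (D := D) (y := y) (e := -(2 * D.ℓ)) (i := D.win y - 2)
    (j := D.phase y) (by rw [emod_eq]; ring) (by omega) (phase_nonneg y) (phase_lt y)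
    (fits_of_le hs (by omega))
  rw [← sub_eq_add_neg] at h3 h4 h5
  refine ⟨?_, h3, h4, h5⟩
  rw [kind_eq_of_win (by omega), h4]
  omega

lemma add_length (y : ℤ) (hL : 0 < D.L) :
    (y + D.L) / D.L = y / D.L + 1 ∧ (y + D.L) % D.L = y % D.L :=
  ⟨by rw [Int.add_ediv_of_dvd_right (dvd_refl _), Int.ediv_self hL.ne'], by simp⟩

lemma sub_length (y : ℤ) (hL : 0 < D.L) :
    (y - D.L) / D.L = y / D.L - 1 ∧ (y - D.L) % D.L = y % D.L :=
  ⟨by rw [Int.sub_ediv_of_dvd _ (dvd_refl _), Int.ediv_self hL.ne'], by simp⟩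

lemma partner_of_kind_one {r a y : ℤ} (h : D.kind (r, a, y) = 1) (hs : D.Site (r, a, y)) :
    D.kind (r, a, y + (D.L + 2 * D.ℓ)) = 3 ∧ (y + (D.L + 2 * D.ℓ)) / D.L = y / D.L + 1 ∧
      D.win (y + (D.L + 2 * D.ℓ)) = D.win y + 2 ∧
      D.phase (y + (D.L + 2 * D.ℓ)) = D.phase y := by
  obtain ⟨h1, h2⟩ := win_lt_of_kind_ne (D := D) (r := r) (a := a) (y := y) (by omega)
  have hL := length_pos hs
  have hw := win_nonneg (D := D) (y := y) hL
  obtain ⟨h6, h7⟩ := add_length (D := D) y hL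
  obtain ⟨h3, h4, h5⟩ := move (D := D) (y := y + D.L) (e := 2 * D.ℓ) (i := D.win y + 2)
    (j := D.phase y) (by rw [h7, emod_eq]; ring) (by omega) (phase_nonneg y) (phase_lt y)
    (fits_of_le hs (by omega))
  rw [add_assoc] at h3 h4 h5
  refine ⟨?_, h3.trans h6, h4, h5⟩
  rw [kind_eq_of_win (by omega), h4]
  omega

lemma partner_of_kind_three {r a y : ℤ} (h : D.kind (r, a, y) = 3) (hs : D.Site (r, a, y)) :
    D.kind (r, a, y - (D.L + 2 * D.ℓ)) = 1 ∧ (y - (D.L + 2 * D.ℓ)) / D.L = y / D.L - 1 ∧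
      D.win (y - (D.L + 2 * D.ℓ)) = D.win y - 2 ∧
      D.phase (y - (D.L + 2 * D.ℓ)) = D.phase y := by
  obtain ⟨h1, h2⟩ := win_lt_of_kind_ne (D := D) (r := r) (a := a) (y := y) (by omega)
  have hL := length_pos hs
  have hw := win_nonneg (D := D) (y := y) hL
  obtain ⟨h6, h7⟩ := sub_length (D := D) y hL
  obtain ⟨h3, h4, h5⟩ := move (D := D) (y := y - D.L) (e := -(2 * D.ℓ)) (i := D.win y - 2)
    (j := D.phase y) (by rw [h7, emod_eq]; ring) (by omega) (phase_nonneg y) (phase_lt y)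
    (fits_of_le hs (by omega))
  rw [show y - D.L + -(2 * D.ℓ) = y - (D.L + 2 * D.ℓ) by ring] at h3 h4 h5
  refine ⟨?_, h3.trans h6, h4, h5⟩
  rw [kind_eq_of_win (by omega), h4]
  omega

/-- The four types of exchanges, with the place of the partner. -/
lemma exchanged_cases {r a y : ℤ} (h : D.Exchanged (r, a, y)) :
    ∃ r' y', D.partner (r, a, y) = (r', a, y') ∧ D.Site (r, a, y) ∧ D.Site (r', a, y') ∧
      D.phase y' = D.phase y ∧ D.win y < 4 * D.g r a - 3 ∧ D.win y' < 4 * D.g r' a - 3 ∧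
      D.kind (r, a, y) = D.win y % 4 ∧ D.kind (r', a, y') = D.win y' % 4 ∧
      ((D.kind (r, a, y) = 0 ∧ D.kind (r', a, y') = 2 ∧ r' = r - D.L ∧ y' = y + 2 * D.ℓ ∧
          y' / D.L = y / D.L ∧ D.g r' a = D.g r a + 1 ∧ D.win y' = D.win y + 2) ∨
       (D.kind (r, a, y) = 1 ∧ D.kind (r', a, y') = 3 ∧ r' = r ∧ y' = y + (D.L + 2 * D.ℓ) ∧
          y' / D.L = y / D.L + 1 ∧ D.win y' = D.win y + 2) ∨
       (D.kind (r, a, y) = 2 ∧ D.kind (r', a, y') = 0 ∧ r' = r + D.L ∧ y' = y - 2 * D.ℓ ∧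
          y' / D.L = y / D.L ∧ D.g r a = D.g r' a + 1 ∧ D.win y' = D.win y - 2) ∨
       (D.kind (r, a, y) = 3 ∧ D.kind (r', a, y') = 1 ∧ r' = r ∧ y' = y - (D.L + 2 * D.ℓ) ∧
          y' / D.L = y / D.L - 1 ∧ D.win y' = D.win y - 2)) := by
  obtain ⟨h1, h2, h3⟩ := h
  have hw := win_lt_of_kind_ne h1
  have hk := kind_cases (D := D) (r, a, y)
  rcases hk with hk | hk | hk | hk | hk
  · simp only [partner, hk, if_true] at h3 ⊢
    obtain ⟨e1, e2, e3, e4⟩ := partner_of_kind_zero hk h2 h3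
    have hw' := win_lt_of_kind_ne (D := D) (r := r - D.L) (a := a) (y := y + 2 * D.ℓ) (by omega)
    have hg := D.g_step h3 (y' := y) (by rwa [sub_add_cancel])
    rw [sub_add_cancel] at hg
    exact ⟨_, _, rfl, h2, h3, e4, hw.1, hw'.1, hk ▸ hw.2, hw'.2,
      Or.inl ⟨trivial, e1, rfl, rfl, e2, hg, e3⟩⟩
  · simp only [partner, hk, one_ne_zero, if_false, if_true] at h3 ⊢
    obtain ⟨e1, e2, e3, e4⟩ := partner_of_kind_one hk h2
    have hw' := win_lt_of_kind_ne (D := D) (r := r) (a := a) (y := y + (D.L + 2 * D.ℓ)) (by omega)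
    exact ⟨_, _, rfl, h2, h3, e4, hw.1, hw'.1, hk ▸ hw.2, hw'.2,
      Or.inr (Or.inl ⟨trivial, e1, rfl, rfl, e2, e3⟩)⟩
  · simp only [partner, hk, OfNat.ofNat_ne_zero, OfNat.ofNat_ne_one, if_false, if_true] at h3 ⊢
    obtain ⟨e1, e2, e3, e4⟩ := partner_of_kind_two hk h2 h3
    have hw' := win_lt_of_kind_ne (D := D) (r := r + D.L) (a := a) (y := y - 2 * D.ℓ) (by omega)
    exact ⟨_, _, rfl, h2, h3, e4, hw.1, hw'.1, hk ▸ hw.2, hw'.2,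
      Or.inr (Or.inr (Or.inl ⟨trivial, e1, rfl, rfl, e2, D.g_step h2 h3, e3⟩))⟩
  · simp only [partner, hk, OfNat.ofNat_ne_zero, OfNat.ofNat_ne_one, if_false, if_true,
      show (3 : ℤ) ≠ 2 by norm_num] at h3 ⊢
    obtain ⟨e1, e2, e3, e4⟩ := partner_of_kind_three hk h2
    have hw' := win_lt_of_kind_ne (D := D) (r := r) (a := a) (y := y - (D.L + 2 * D.ℓ)) (by omega)
    exact ⟨_, _, rfl, h2, h3, e4, hw.1, hw'.1, hk ▸ hw.2, hw'.2,
      Or.inr (Or.inr (Or.inr ⟨trivial, e1, rfl, rfl, e2, e3⟩))⟩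
  · exact absurd hk h1

lemma Exchanged.partner_partner {p : ℤ × ℤ × ℤ} (h : D.Exchanged p) :
    D.partner (D.partner p) = p := by
  obtain ⟨r, a, y⟩ := p
  obtain ⟨r', y', h1, -, -, -, -, -, -, -, h2⟩ := exchanged_cases h
  rw [h1]
  rcases h2 with ⟨-, e, rfl, rfl, -⟩ | ⟨-, e, rfl, rfl, -⟩ | ⟨-, e, rfl, rfl, -⟩ |
    ⟨-, e, rfl, rfl, -⟩ <;> simp [partner, e]

lemma Exchanged.partner {p : ℤ × ℤ × ℤ} (h : D.Exchanged p) : D.Exchanged (D.partner p) := by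
  refine ⟨?_, h.2.2, by rw [h.partner_partner]; exact h.2.1⟩
  obtain ⟨r, a, y⟩ := p
  obtain ⟨r', y', h1, -, -, -, -, -, -, -, h2⟩ := exchanged_cases h
  rw [h1]
  omega

lemma div_mul_le (y : ℤ) (hL : 0 < D.L) : y / D.L * D.L ≤ y ∧ y < (y / D.L + 1) * D.L := by
  constructor
  · exact Int.ediv_mul_le _ hL.ne'
  · exact Int.lt_ediv_add_one_mul_self y hL

/-- Near a good corner, all sites are followed by a site, and exchanged according to their type. -/
lemma of_good {p : ℤ × ℤ × ℤ} (hs : D.Site p) (hg : D.Good (D.vertex p)) :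
    D.Site (succ p) ∧ (D.kind p ≠ 4 → D.Exchanged p ∧ D.Site (succ (D.partner p))) := by
  obtain ⟨r, a, y⟩ := p
  have hL := length_pos hs
  obtain ⟨l1, l2⟩ := div_mul_le (D := D) y hL
  have hℓ := D.window_pos
  have hw := win_nonneg (D := D) (y := y) hL
  have hm := emod_eq (D := D) y
  have hm' := Int.emod_lt_of_pos y hL
  have hm'' := Int.mul_ediv_add_emod y D.L
  have hph := phase_nonneg (D := D) y
  have hphl := phase_lt (D := D) y
  rcases kind_cases (D := D) (r, a, y) with hk | hk | hk | hk | hk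
  · obtain ⟨h1, h2⟩ := win_lt_of_kind_ne (D := D) (r := r) (a := a) (y := y) (by omega)
    have hf := fits_of_le (i := D.win y + 2) hs (by omega)
    simp only [vertex, hk, succ, partner, Exchanged] at hg ⊢
    norm_num at hg ⊢
    have hy1 : y + 1 ≤ (y / D.L + 1) * D.L := by linarith
    have hy2 : y + 2 * D.ℓ + 1 ≤ (y / D.L + 1) * D.L := by nlinarith
    exact ⟨(D.site_of_good hg (by nlinarith) hy1).1,
      ⟨hs, (D.site_of_good hg (by nlinarith) (by linarith)).2⟩,
      (D.site_of_good hg (by nlinarith) hy2).2⟩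
  · obtain ⟨h1, h2⟩ := win_lt_of_kind_ne (D := D) (r := r) (a := a) (y := y) (by omega)
    have hf := fits_of_le (i := D.win y + 2) hs (by omega)
    simp only [vertex, hk, succ, partner, Exchanged] at hg ⊢
    norm_num at hg ⊢
    have hy1 : y + 1 ≤ (y / D.L + 1) * D.L := by linarith
    have hy2 : y + 2 * D.ℓ + 1 ≤ (y / D.L + 1) * D.L := by nlinarith
    exact ⟨(D.site_of_good hg (by nlinarith) (by nlinarith)).1,
      ⟨hs, (D.site_of_good hg (by nlinarith) (by nlinarith)).1⟩,
      (D.site_of_good hg (by nlinarith) (by nlinarith)).1⟩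
  · obtain ⟨h1, h2⟩ := win_lt_of_kind_ne (D := D) (r := r) (a := a) (y := y) (by omega)
    simp only [vertex, hk, succ, partner, Exchanged] at hg ⊢
    norm_num at hg ⊢
    have hy1 : y + 1 ≤ (y / D.L + 1) * D.L := by linarith
    -- Windows of type 2 or 3 have index at least 2, so moving back by two windows stays in the
    -- column.
    have hw2 : 2 ≤ D.win y := by omega
    have hy2 : y / D.L * D.L ≤ y - 2 * D.ℓ := by nlinarith
    have e1 := D.site_of_good hg (y := y + 1) (by nlinarith) (by nlinarith)
    rw [add_sub_cancel_right] at e1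
    exact ⟨e1.2, ⟨hs, (D.site_of_good hg (by nlinarith) (by nlinarith)).1⟩,
      (D.site_of_good hg (by nlinarith) (by nlinarith)).1⟩
  · obtain ⟨h1, h2⟩ := win_lt_of_kind_ne (D := D) (r := r) (a := a) (y := y) (by omega)
    simp only [vertex, hk, succ, partner, Exchanged] at hg ⊢
    norm_num at hg ⊢
    have hy1 : y + 1 ≤ (y / D.L + 1) * D.L := by linarith
    have hw2 : 2 ≤ D.win y := by omega
    have hy2 : y / D.L * D.L ≤ y - 2 * D.ℓ := by nlinarith
    have e1 := D.site_of_good hg (y := y + 1) (by nlinarith) (by nlinarith)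
    have e2 := D.site_of_good hg (y := y - (D.L + 2 * D.ℓ)) (by nlinarith) (by nlinarith)
    have e3 := D.site_of_good hg (y := y - (D.L + 2 * D.ℓ) + 1) (by nlinarith) (by nlinarith)
    rw [add_sub_cancel_right] at e1 e2 e3
    exact ⟨e1.2, ⟨hs, e2.2⟩, e3.2⟩
  · simp only [vertex, hk, succ] at hg ⊢
    norm_num at hg ⊢
    exact (D.site_of_good hg (by nlinarith) (by nlinarith)).1

/-- Inside a window, the next site has the same type. -/
lemma succ_of_phase_lt {r a y : ℤ} (hs : D.Site (r, a, y)) (h4 : D.kind (r, a, y) ≠ 4)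
    (hph : D.phase y + 1 < D.ℓ) :
    D.kind (r, a, y + 1) = D.kind (r, a, y) ∧ (y + 1) / D.L = y / D.L ∧
      D.phase (y + 1) = D.phase y + 1 := by
  obtain ⟨h1, h2⟩ := win_lt_of_kind_ne h4
  obtain ⟨e1, e2, e3⟩ := move (D := D) (y := y) (e := 1) (i := D.win y) (j := D.phase y + 1)
    (by rw [emod_eq]; ring) (win_nonneg (length_pos hs)) (by linarith [phase_nonneg (D := D) y]) hph
    (fits_of_le hs (by omega))
  exact ⟨by rw [kind_eq_of_win (by omega), h2, e2], e1, e3⟩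

/-- At the end of a window, the next site starts the next window. -/
lemma succ_of_phase_eq {r a y : ℤ} (hs : D.Site (r, a, y)) (h4 : D.kind (r, a, y) ≠ 4)
    (hph : D.phase y + 1 = D.ℓ) :
    D.win (y + 1) = D.win y + 1 ∧ (y + 1) / D.L = y / D.L ∧ D.phase (y + 1) = 0 := by
  obtain ⟨h1, h2⟩ := win_lt_of_kind_ne h4
  have hℓ := D.window_pos
  obtain ⟨e1, e2, e3⟩ := move (D := D) (y := y) (e := 1) (i := D.win y + 1) (j := 0)
    (by rw [emod_eq, add_assoc, hph]; ring) (by linarith [win_nonneg (y := y) (length_pos hs)])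
    le_rfl hℓ (fits_of_le hs (by omega))
  exact ⟨e2, e1, e3⟩

lemma vertex_succ_of_phase_lt {r a y : ℤ} (hs : D.Site (r, a, y)) (h4 : D.kind (r, a, y) ≠ 4)
    (hph : D.phase y + 1 < D.ℓ) : D.vertex (r, a, y + 1) = D.vertex (r, a, y) := by
  obtain ⟨e1, e2, -⟩ := succ_of_phase_lt hs h4 hph
  simp only [vertex, e1, e2]

lemma partner_succ_of_phase_lt {r a y : ℤ} (hs : D.Site (r, a, y)) (h4 : D.kind (r, a, y) ≠ 4)
    (hph : D.phase y + 1 < D.ℓ) : D.partner (r, a, y + 1) = succ (D.partner (r, a, y)) := by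
  obtain ⟨e1, e2, -⟩ := succ_of_phase_lt hs h4 hph
  simp only [partner, succ, e1]
  split_ifs <;> simp <;> ring

/-- After a quarter turn the path has passed to the partner, and it enters the window after the
partner's. The types succeed each other as 0, 3, 2, 1, 0, always at the same corner, and the window
index changes by +3, -1, -1, +3: one turn around the corner advances it by four. -/
lemma vertex_succ_partner_of_phase_eq {r a y : ℤ} (h : D.Exchanged (r, a, y))
    (hph : D.phase y + 1 = D.ℓ) :
    D.vertex (succ (D.partner (r, a, y))) = D.vertex (r, a, y) ∧
      D.phase (succ (D.partner (r, a, y))).2.2 = 0 := by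
  obtain ⟨r', y', h1, h2, h3, h4, h5, h6, h7, h8, h9⟩ := exchanged_cases h
  have hpk : D.kind (r', a, y') ≠ 4 := by omega
  obtain ⟨e1, e2, e3⟩ := succ_of_phase_eq h3 hpk (by rw [h4]; exact hph)
  rw [h1]
  refine ⟨?_, e3⟩
  simp only [vertex, succ, e2]
  rcases h9 with ⟨c1, c2, c3, c4, c5, c6, c7⟩ | ⟨c1, c2, c3, c4, c5, c6⟩ |
    ⟨c1, c2, c3, c4, c5, c6, c7⟩ | ⟨c1, c2, c3, c4, c5, c6⟩
  · have : D.kind (r', a, y' + 1) = 3 := by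
      rw [kind_eq_of_win (by omega), e1]; omega
    simp only [this, c1]; simp [c3, c5]
  · have : D.kind (r', a, y' + 1) = 0 := by
      rw [c3] at h6
      rw [kind_eq_of_win (by rw [c3]; omega), e1]; omega
    simp only [this, c1]; simp [c3, c5]
  -- The partner's window may be the last typed one, of index 4g - 4; the path then leaves the
  -- spiral and runs along the untyped rest of the column.
  · have : D.kind (r', a, y' + 1) = 1 ∨ D.kind (r', a, y' + 1) = 4 := by
      by_cases hlt : D.win (y' + 1) < 4 * D.g r' a - 3
      · left; rw [kind_eq_of_win hlt, e1]; omega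
      · right; exact kind_eq_four_of_win (by omega)
    rcases this with this | this <;> simp only [this, c1] <;> simp [c3, c5]
  · have : D.kind (r', a, y' + 1) = 2 := by
      rw [c3] at h6
      rw [kind_eq_of_win (by rw [c3]; omega), e1]; omega
    simp only [this, c1]; simp [c3, c5]

/-- The untyped rest of a column belongs to the corner at its right end. The next column begins with
window 0, of type 0 since g ≥ 1, which belongs to its left corner: the same one. There the path
closes up. -/
lemma vertex_succ_of_kind_four {r a y : ℤ} (hs : D.Site (r, a, y)) (h4 : D.kind (r, a, y) = 4) :
    D.vertex (r, a, y + 1) = D.vertex (r, a, y) ∧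
      (D.kind (r, a, y + 1) = 4 ∨ D.phase (y + 1) = 0) := by
  have hL := length_pos hs
  have hℓ := D.window_pos
  have hw : 4 * D.g r a - 3 ≤ D.win y := by
    by_contra hlt
    rw [kind_eq_of_win (by omega)] at h4
    omega
  by_cases hlast : y % D.L + 1 < D.L
  · obtain ⟨e1, e2⟩ := ediv_emod_add (y := y) (e := 1) (L := D.L)
      (by linarith [Int.emod_nonneg y hL.ne']) hlast
    have : D.kind (r, a, y + 1) = 4 := by
      apply kind_eq_four_of_win
      refine hw.trans ?_
      rw [win, win, e2]
      exact Int.ediv_le_ediv hℓ (by omega)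
    exact ⟨by simp [vertex, this, h4, e1], Or.inl this⟩
  · have e0 : y % D.L = D.L - 1 := by have := Int.emod_lt_of_pos y hL; omega
    have e1 : y + 1 = (y / D.L + 1) * D.L := by
      have := Int.mul_ediv_add_emod y D.L
      rw [e0] at this; linarith
    have e2 : (y + 1) / D.L = y / D.L + 1 := by
      rw [e1]; exact Int.mul_ediv_cancel _ hL.ne'
    have e3 : (y + 1) % D.L = 0 := by rw [e1]; simp
    have e4 : D.win (y + 1) = 0 := by simp [win, e3]
    have e5 : D.kind (r, a, y + 1) = 0 := by
      rw [kind_eq_of_win (by rw [e4]; linarith [D.g_pos hs]), e4]; rfl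
    exact ⟨by simp [vertex, e5, h4, e2], Or.inr (by simp [phase, e3])⟩

end ExchangeData

/-! ### Rotation angles, and transport of the rotated basis along the paths. -/

namespace ExchangeData

variable (D : ExchangeData)

/-- The angle by which the exchanged bases are rotated from one site to the next. -/
noncomputable def angle : ℝ := Real.pi / (2 * D.ℓ)

/-- The orientation of an exchange. -/
noncomputable def orient (p : ℤ × ℤ × ℤ) : ℝ := if D.kind p = 0 ∨ D.kind p = 1 then 1 else -1

open Classical in
/-- The diagonal entry of the rotation at the angle of the site `p`, moved on by `t` sites. -/
noncomputable def cosAt (t : ℤ) (p : ℤ × ℤ × ℤ) : ℝ :=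
  if D.Exchanged p then Real.cos ((D.phase p.2.2 + t : ℤ) * D.angle) else 1

open Classical in
/-- The off-diagonal entry of the rotation at the angle of the site `p`, moved on by `t` sites. -/
noncomputable def sinAt (t : ℤ) (p : ℤ × ℤ × ℤ) : ℝ :=
  if D.Exchanged p then D.orient p * Real.sin ((D.phase p.2.2 + t : ℤ) * D.angle) else 0

variable {D}

lemma Exchanged.orient_partner {p : ℤ × ℤ × ℤ} (h : D.Exchanged p) :
    D.orient (D.partner p) = - D.orient p := by
  obtain ⟨r, a, y⟩ := p
  obtain ⟨r', y', h1, -, -, -, -, -, -, -, h2⟩ := exchanged_cases h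
  rw [h1]
  rcases h2 with ⟨c1, c2, -⟩ | ⟨c1, c2, -⟩ | ⟨c1, c2, -⟩ | ⟨c1, c2, -⟩ <;>
    simp [orient, c1, c2]

lemma Exchanged.phase_partner {p : ℤ × ℤ × ℤ} (h : D.Exchanged p) :
    D.phase (D.partner p).2.2 = D.phase p.2.2 := by
  obtain ⟨r, a, y⟩ := p
  obtain ⟨r', y', h1, -, -, h2, -⟩ := exchanged_cases h
  rw [h1]; exact h2

lemma orient_sq (p : ℤ × ℤ × ℤ) : D.orient p ^ 2 = 1 := by
  unfold orient; split_ifs <;> norm_num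

lemma cosAt_sq_add_sinAt_sq (t : ℤ) (p : ℤ × ℤ × ℤ) :
    D.cosAt t p ^ 2 + D.sinAt t p ^ 2 = 1 := by
  unfold cosAt sinAt
  split_ifs
  · rw [mul_pow, orient_sq, one_mul, Real.cos_sq_add_sin_sq]
  · norm_num

/-- A chord is shorter than its arc: 2 - 2 cos θ ≤ θ². -/
lemma rotation_step (p : ℤ × ℤ × ℤ) :
    (D.cosAt 1 p - D.cosAt 0 p) ^ 2 + (D.sinAt 1 p - D.sinAt 0 p) ^ 2 ≤ D.angle ^ 2 := by
  unfold cosAt sinAt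
  split_ifs
  · rw [← mul_sub, mul_pow, orient_sq, one_mul]
    set α := ((D.phase p.2.2 + 0 : ℤ) : ℝ) * D.angle with hα
    have : ((D.phase p.2.2 + 1 : ℤ) : ℝ) * D.angle = α + D.angle := by
      rw [hα]; push_cast; ring
    rw [this]
    have h1 := Real.cos_sq_add_sin_sq α
    have h2 := Real.cos_sq_add_sin_sq (α + D.angle)
    have h3 : Real.cos D.angle = Real.cos (α + D.angle) * Real.cos α
        + Real.sin (α + D.angle) * Real.sin α := by
      rw [← Real.cos_sub]; congr 1; ring
    have h4 := Real.one_sub_sq_div_two_le_cos (x := D.angle)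
    nlinarith
  · simp only [sub_self]; nlinarith [sq_nonneg D.angle]

section Embedding

variable {X : Type} {coord : X → ℤ × ℤ × ℤ}

open Classical in
/-- The exchange, on a set of points embedded in the sites. -/
noncomputable def exchange (D : ExchangeData) (hsite : ∀ p, D.Site p → ∃ x, coord x = p)
    (x : X) : X :=
  if h : D.Exchanged (coord x) then (hsite _ h.2.2).choose else x

lemma coord_exchange {hsite : ∀ p, D.Site p → ∃ x, coord x = p} {x : X}
    (h : D.Exchanged (coord x)) : coord (D.exchange hsite x) = D.partner (coord x) := by
  unfold exchange
  rw [dif_pos h]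
  exact (hsite _ h.2.2).choose_spec

lemma exchange_of_not {hsite : ∀ p, D.Site p → ∃ x, coord x = p} {x : X}
    (h : ¬ D.Exchanged (coord x)) : D.exchange hsite x = x := dif_neg h

lemma exchange_involutive (hinj : Function.Injective coord)
    (hsite : ∀ p, D.Site p → ∃ x, coord x = p) : Function.Involutive (D.exchange hsite) := by
  intro x
  by_cases h : D.Exchanged (coord x)
  · have h1 := coord_exchange (hsite := hsite) h
    have h2 : D.Exchanged (coord (D.exchange hsite x)) := by rw [h1]; exact h.partner
    apply hinj
    rw [coord_exchange h2, h1, h.partner_partner]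
  · rw [exchange_of_not h, exchange_of_not h]

lemma cosAt_exchange {hsite : ∀ p, D.Site p → ∃ x, coord x = p} (t : ℤ) (x : X) :
    D.cosAt t (coord (D.exchange hsite x)) = D.cosAt t (coord x) := by
  by_cases h : D.Exchanged (coord x)
  · rw [coord_exchange h]
    simp only [cosAt, h, h.partner, if_true, h.phase_partner]
  · rw [exchange_of_not h]

lemma sinAt_exchange {hsite : ∀ p, D.Site p → ∃ x, coord x = p} (t : ℤ) (x : X) :
    D.sinAt t (coord (D.exchange hsite x)) = - D.sinAt t (coord x) := by
  by_cases h : D.Exchanged (coord x)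
  · rw [coord_exchange h]
    simp only [sinAt, h, h.partner, if_true, h.phase_partner, h.orient_partner, neg_mul]
  · rw [exchange_of_not h]; simp [sinAt, h]

lemma cosAt_zero_of_phase {p : ℤ × ℤ × ℤ} (h : D.phase p.2.2 = 0) : D.cosAt 0 p = 1 := by
  unfold cosAt; split_ifs <;> simp [h]

lemma sinAt_zero_of_phase {p : ℤ × ℤ × ℤ} (h : D.phase p.2.2 = 0) : D.sinAt 0 p = 0 := by
  unfold sinAt; split_ifs <;> simp [h]

/-- In the rotated basis, the shift moves a basis vector near a good corner to a multiple of
another one near the same corner. -/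
lemma exists_path [DecidableEq X] (hinj : Function.Injective coord)
    (hsite : ∀ p, D.Site p → ∃ x, coord x = p) {s : Equiv.Perm X}
    (hsucc : ∀ x, D.Site (coord x) → D.Site (succ (coord x)) → coord (s x) = succ (coord x))
    {x : X} (hx : D.Site (coord x)) (hg : D.Good (D.vertex (coord x))) :
    ∃ (y : X) (ε : ℂ), D.Site (coord y) ∧ D.vertex (coord y) = D.vertex (coord x) ∧
      (D.cosAt 1 (coord x) : ℂ) • Pi.single (s x) (1 : ℂ)
          + (D.sinAt 1 (coord x) : ℂ) • Pi.single (s (D.exchange hsite x)) 1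
        = ε • ((D.cosAt 0 (coord y) : ℂ) • Pi.single y (1 : ℂ)
          + (D.sinAt 0 (coord y) : ℂ) • Pi.single (D.exchange hsite y) 1) := by
  obtain ⟨h1, h2⟩ := of_good hx hg
  have hsx := hsucc x hx h1
  by_cases h4 : D.kind (coord x) = 4
  · have hne : ¬ D.Exchanged (coord x) := fun h => h.1 h4
    obtain ⟨v1, v2⟩ := vertex_succ_of_kind_four (r := (coord x).1) (a := (coord x).2.1)
      (y := (coord x).2.2) hx h4
    refine ⟨s x, 1, by rw [hsx]; exact h1, by rw [hsx]; exact v1, ?_⟩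
    have e1 : D.cosAt 1 (coord x) = 1 := by simp [cosAt, hne]
    have e2 : D.sinAt 1 (coord x) = 0 := by simp [sinAt, hne]
    have e3 : D.cosAt 0 (coord (s x)) = 1 ∧ D.sinAt 0 (coord (s x)) = 0 := by
      rw [hsx]
      rcases v2 with v2 | v2
      · have : ¬ D.Exchanged (succ (coord x)) := fun h => h.1 v2
        simp [cosAt, sinAt, this]
      · exact ⟨cosAt_zero_of_phase v2, sinAt_zero_of_phase v2⟩
    rw [e1, e2, e3.1, e3.2]
    simp
  · obtain ⟨hex, hps⟩ := h2 h4
    have hτ := coord_exchange (hsite := hsite) hex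
    have hsτ : coord (s (D.exchange hsite x)) = succ (D.partner (coord x)) := by
      rw [hsucc _ (by rw [hτ]; exact hex.2.2) (by rw [hτ]; exact hps), hτ]
    have hlt := phase_lt (D := D) (coord x).2.2
    rcases (show D.phase (coord x).2.2 + 1 < D.ℓ ∨ D.phase (coord x).2.2 + 1 = D.ℓ by omega) with
      hph | hph
    · obtain ⟨k1, k2, k3⟩ := succ_of_phase_lt (r := (coord x).1) (a := (coord x).2.1) hx h4 hph
      have k4 := vertex_succ_of_phase_lt (r := (coord x).1) (a := (coord x).2.1) hx h4 hph
      have k5 := partner_succ_of_phase_lt (r := (coord x).1) (a := (coord x).2.1) hx h4 hph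
      have hex' : D.Exchanged (coord (s x)) := by
        rw [hsx]
        refine ⟨?_, h1, ?_⟩
        · rw [succ, k1]; exact h4
        · rw [succ, k5]; exact hps
      have hτs : D.exchange hsite (s x) = s (D.exchange hsite x) := by
        apply hinj
        rw [coord_exchange hex', hsτ, hsx]; exact k5
      refine ⟨s x, 1, by rw [hsx]; exact h1, by rw [hsx]; exact k4, ?_⟩
      have ho : D.orient (coord (s x)) = D.orient (coord x) := by
        rw [hsx]; simp only [orient, succ, k1]
      have hp : D.phase (coord (s x)).2.2 + 0 = D.phase (coord x).2.2 + 1 := by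
        rw [hsx, add_zero]; exact k3
      simp only [cosAt, sinAt, hex, hex', if_true, ho, hp, hτs, one_smul]
    · obtain ⟨k1, k2⟩ := vertex_succ_partner_of_phase_eq (r := (coord x).1) (a := (coord x).2.1)
        hex hph
      have hℓ : (D.ℓ : ℝ) ≠ 0 := by exact_mod_cast D.window_pos.ne'
      -- At the end of a window the rotation is a full exchange up to sign, and at phase 0 of the
      -- next window it is the identity, so the two fit together.
      have hang : ((D.phase (coord x).2.2 + 1 : ℤ) : ℝ) * D.angle = Real.pi / 2 := by
        rw [hph, angle]; field_simp
      refine ⟨s (D.exchange hsite x), (D.orient (coord x) : ℂ), by rw [hsτ]; exact hps,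
        by rw [hsτ]; exact k1, ?_⟩
      rw [← hsτ] at k2
      rw [cosAt_zero_of_phase k2, sinAt_zero_of_phase k2]
      simp only [cosAt, sinAt, hex, if_true, hang, Real.cos_pi_div_two, Real.sin_pi_div_two]
      simp

open Classical in
/-- A family of weighted shifts with slowly varying weights is close to a normal matrix that
commutes with a matrix close to the position. -/
theorem exists_normal [Fintype X] [DecidableEq X] (D : ExchangeData)
    (hinj : Function.Injective coord) (hsite : ∀ p, D.Site p → ∃ x, coord x = p)
    (s : Equiv.Perm X)
    (hsucc : ∀ x, D.Site (coord x) → D.Site (succ (coord x)) → coord (s x) = succ (coord x))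
    (hL : 0 < D.L) {ω : ℤ × ℤ × ℤ → ℝ} {w₀ ν : X → ℝ} {κ ε K : ℝ} (hκ : 0 ≤ κ) (hε : 0 ≤ ε)
    (hgood : ∀ x, D.Site (coord x) → D.Good (D.vertex (coord x)) →
      |ω (D.vertex (coord x)) - w₀ x| ≤ ε)
    (hbad : ∀ x, ¬ (D.Site (coord x) ∧ D.Good (D.vertex (coord x))) → |w₀ x| ≤ ε)
    (hexc : ∀ x x', D.Exchanged (coord x) → coord x' = D.partner (coord x) → |w₀ x - w₀ x'| ≤ ε)
    (hK : ∀ x, |w₀ x| ≤ K) (hK0 : 0 ≤ K)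
    (hν : ∀ x, ((coord x).2.2 / D.L : ℤ) * (D.L : ℝ) ≤ ν x ∧
      ν x ≤ (((coord x).2.2 / D.L : ℤ) + 1) * (D.L : ℝ)) :
    ∃ W A : Matrix X X ℂ, W * Wᴴ = Wᴴ * W ∧ A.IsHermitian ∧ W * A = A * W ∧
      IsRealMatrix W ∧ IsRealMatrix A ∧
      ‖W - shiftMatrix s * realDiag w₀‖ ≤ 2 * ε + D.angle * K ∧
      ‖A - realDiag fun x => κ * ν x‖ ≤ κ * D.L := by
  have hL' : (0 : ℝ) < D.L := by exact_mod_cast hL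
  set τ : Equiv.Perm X := (exchange_involutive hinj hsite).toPerm with hτdef
  have hτx : ∀ x, τ x = D.exchange hsite x := fun x => rfl
  have hτ : ∀ x, τ (τ x) = x := exchange_involutive hinj hsite
  have hdiff : ∀ x, |w₀ x - w₀ (τ x)| ≤ ε := by
    intro x
    by_cases h : D.Exchanged (coord x)
    · exact hexc x _ h (coord_exchange (hsite := hsite) h)
    · rw [hτx, exchange_of_not h, sub_self, abs_zero]; exact hε
  -- One weight for each good corner, zero elsewhere: the paths are needed only at good corners.
  let w : X → ℝ := fun x =>
    if D.Site (coord x) ∧ D.Good (D.vertex (coord x)) then ω (D.vertex (coord x)) else 0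
  let c : X → ℝ := fun x => κ * (((D.vertex (coord x)).2.2 : ℝ) * D.L)
  let vert : X → Prop := fun x => D.kind (coord x) = 0 ∨ D.kind (coord x) = 2
  -- Partners in neighbouring columns have the same corner position, which is then its own bound.
  -- Partners in one column (types 0 and 2) have its two ends as corner positions, and these ends
  -- are the bounds. In both cases the bounds are within L of the true position.
  let lo : X → ℝ := fun x => κ * (if vert x then ((coord x).2.2 / D.L : ℤ) * (D.L : ℝ)
    else ((D.vertex (coord x)).2.2 : ℝ) * D.L)
  let hi : X → ℝ := fun x => κ * (if vert x then (((coord x).2.2 / D.L : ℤ) + 1) * (D.L : ℝ)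
    else ((D.vertex (coord x)).2.2 : ℝ) * D.L)
  have hlohi : ∀ x, lo (τ x) = lo x ∧ hi (τ x) = hi x := by
    intro x
    by_cases h : D.Exchanged (coord x)
    · have h1 := coord_exchange (hsite := hsite) h
      rw [hτx]
      simp only [lo, hi, vert, h1]
      clear h1
      generalize coord x = p at h ⊢
      obtain ⟨r, a, y⟩ := p
      obtain ⟨r', y', h2, -, -, -, -, -, -, -, h3⟩ := exchanged_cases h
      rw [h2]
      rcases h3 with ⟨c1, c2, -, -, c5, -⟩ | ⟨c1, c2, -, -, c5, -⟩ | ⟨c1, c2, -, -, c5, -⟩ |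
        ⟨c1, c2, -, -, c5, -⟩ <;> simp [vertex, c1, c2, c5]
    · rw [hτx, exchange_of_not h]; exact ⟨rfl, rfl⟩
  have hvert : ∀ x, (D.vertex (coord x)).2.2 = (coord x).2.2 / D.L ∨
      (D.vertex (coord x)).2.2 = (coord x).2.2 / D.L + 1 := by
    intro x
    simp only [vertex]; split_ifs <;> simp
  have hbound : ∀ x, w x - w₀ x ≤ ε ∧ w₀ x - w x ≤ ε := by
    intro x
    by_cases h : D.Site (coord x) ∧ D.Good (D.vertex (coord x))
    · have := abs_le.mp (hgood x h.1 h.2)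
      simp only [w, h, and_self, if_true]
      constructor <;> linarith
    · have := abs_le.mp (hbad x h)
      simp only [w, h, if_false]
      constructor <;> linarith
  obtain ⟨W, A, h1, h2, h3, h4, h5, h6, h7⟩ := exists_normal_commute_of_exchange s τ hτ
    (a := fun x => D.cosAt 0 (coord x)) (b := fun x => D.sinAt 0 (coord x))
    (a' := fun x => D.cosAt 1 (coord x)) (b' := fun x => D.sinAt 1 (coord x))
    (cosAt_exchange (hsite := hsite) 0) (sinAt_exchange (hsite := hsite) 0)
    (cosAt_exchange (hsite := hsite) 1) (sinAt_exchange (hsite := hsite) 1)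
    (fun x => cosAt_sq_add_sinAt_sq 0 _) (fun x => cosAt_sq_add_sinAt_sq 1 _)
    -- The pair average is within ε/2 of `w₀`, hence within 3ε/2 of `w`.
    (w₀ := w₀) (w := w) (wm := fun x => (w₀ x + w₀ (τ x)) / 2) (c := c) (lo := lo) (hi := hi)
    (μ := fun x => κ * ν x) (δ := D.angle) (K := K) (ε₁ := 3 / 2 * ε) (ε₂ := ε / 2)
    (η := κ * D.L)
    (fun x => by rw [hτ, add_comm]) (fun x => (hlohi x).1) (fun x => (hlohi x).2)
    (by
      intro x hx
      have hx' : D.Site (coord x) ∧ D.Good (D.vertex (coord x)) := by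
        by_contra h
        simp [w, h] at hx
      obtain ⟨y, e, k1, k2, k3⟩ := exists_path hinj hsite hsucc hx'.1 hx'.2
      refine ⟨y, e, ?_, ?_, k3⟩
      · simp only [w, k1, k2, hx', and_self, if_true]
      · simp only [c, k2])
    (by unfold angle; have := D.window_pos; positivity) hK0 (by linarith) (by linarith)
    (by positivity)
    (fun x => rotation_step _)
    (by
      intro x
      have k1 := abs_le.mp (hK x)
      have k2 := abs_le.mp (hK (τ x))
      rw [abs_le]; constructor <;> linarith)
    (by
      intro x
      have k1 := abs_le.mp (hdiff x)
      have k2 := hbound x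
      rw [abs_le]; constructor <;> linarith)
    (by
      intro x
      have k1 := abs_le.mp (hdiff x)
      rw [abs_le]; constructor <;> linarith)
    (by
      intro x
      simp only [lo, c]
      refine mul_le_mul_of_nonneg_left ?_ hκ
      split_ifs with hv
      · rcases hvert x with h | h <;> rw [h] <;> push_cast <;> nlinarith
      · exact le_rfl)
    (by
      intro x
      simp only [hi, c]
      refine mul_le_mul_of_nonneg_left ?_ hκ
      split_ifs with hv
      · rcases hvert x with h | h <;> rw [h] <;> push_cast <;> nlinarith
      · exact le_rfl)
    (by
      intro x
      have := hν x
      simp only [hi]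
      rw [← mul_add]
      refine mul_le_mul_of_nonneg_left ?_ hκ
      split_ifs with hv
      · linarith
      · rcases hvert x with h | h <;> rw [h] <;> push_cast <;> linarith)
    (by
      intro x
      have := hν x
      simp only [lo]
      rw [← mul_add]
      refine mul_le_mul_of_nonneg_left ?_ hκ
      split_ifs with hv
      · linarith
      · rcases hvert x with h | h <;> rw [h] <;> push_cast <;> linarith)
  exact ⟨W, A, h1, h2, h3, h4, h5, h6.trans (by linarith), h7⟩

end Embedding

end ExchangeData

/-! ### The scaled spin matrices as weighted shifts, and the variation of their weights. -/

/-- The cyclic shift of the standard basis of each summand. -/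
def siteSucc {m : ℕ} (d n : Fin m → ℕ) : Equiv.Perm (SumIndex d n) :=
  Equiv.sigmaCongrRight fun p => finRotate (d p.1 + 1)

/-- The weights of the scaled raising matrix. -/
noncomputable def siteWeight (N : ℕ) {m : ℕ} (d n : Fin m → ℕ) (x : SumIndex d n) : ℝ :=
  spinWeight (d x.1.1) (magnetic (d x.1.1) x.2) / N

/-- The scaled raising matrix. -/
noncomputable def scaledPlus (N : ℕ) {m : ℕ} (d n : Fin m → ℕ) :
    Matrix (SumIndex d n) (SumIndex d n) ℂ :=
  shiftMatrix (siteSucc d n) * realDiag (siteWeight N d n)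

lemma irrepPlus_apply (d : ℕ) (i j : Fin (d + 1)) :
    irrepPlus d i j = if i = finRotate (d + 1) j then ((spinWeight d (magnetic d j) : ℝ) : ℂ)
      else 0 := by
  rw [irrepPlus, Matrix.of_apply]
  rcases Fin.eq_castSucc_or_eq_last j with ⟨k, rfl⟩ | rfl
  · simp [Fin.ext_iff]
  -- The weight at the top of a chain vanishes, so closing the shift up cyclically changes nothing.
  · have h0 : spinWeight d (magnetic d (Fin.last d)) = 0 := by
      simp only [spinWeight, magnetic, spin, Fin.val_last]
      rw [show ((d : ℝ) / 2 - ((d : ℝ) - (d : ℝ) / 2)) = 0 by ring]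
      simp
    simp [h0]

lemma scaledPlus_eq (N : ℕ) {m : ℕ} (d n : Fin m → ℕ) :
    scaledPlus N d n = (1 / (N : ℂ)) •
      Matrix.blockDiagonal' fun p : (Σ r : Fin m, Fin (n r)) => irrepPlus (d p.1) := by
  ext ⟨p, i⟩ ⟨q, j⟩
  rw [scaledPlus, realDiag, Matrix.mul_diagonal, Matrix.smul_apply, Matrix.blockDiagonal'_apply]
  by_cases h : p = q
  · subst h
    simp only [dif_pos, cast_eq, irrepPlus_apply, shiftMatrix, Matrix.of_apply, siteSucc,
      Equiv.sigmaCongrRight_apply, Sigma.mk.injEq, heq_eq_eq, true_and, siteWeight]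
    split_ifs <;> simp [div_eq_inv_mul]
  · have : (⟨p, i⟩ : SumIndex d n) ≠ siteSucc d n ⟨q, j⟩ := by
      intro h'
      exact h (congrArg Sigma.fst h')
    simp [shiftMatrix, this, h]

lemma scaledPlus_conjTranspose (N : ℕ) {m : ℕ} (d n : Fin m → ℕ) :
    (scaledPlus N d n)ᴴ = (1 / (N : ℂ)) •
      Matrix.blockDiagonal' fun p : (Σ r : Fin m, Fin (n r)) => irrepMinus (d p.1) := by
  rw [scaledPlus_eq, Matrix.conjTranspose_smul, Matrix.blockDiagonal'_conjTranspose]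
  simp [irrepMinus]

lemma scaledSum_zero (N : ℕ) {m : ℕ} (d n : Fin m → ℕ) :
    scaledSum N d n 0 = (1 / 2 : ℂ) • (scaledPlus N d n + (scaledPlus N d n)ᴴ) := by
  rw [scaledPlus_conjTranspose, scaledPlus_eq, ← smul_add, ← Matrix.blockDiagonal'_add, smul_comm,
    ← Matrix.blockDiagonal'_smul]
  rfl

lemma scaledSum_one (N : ℕ) {m : ℕ} (d n : Fin m → ℕ) :
    scaledSum N d n 1
      = (1 / (2 * Complex.I) : ℂ) • (scaledPlus N d n - (scaledPlus N d n)ᴴ) := by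
  rw [scaledPlus_conjTranspose, scaledPlus_eq, ← smul_sub, ← Matrix.blockDiagonal'_sub, smul_comm,
    ← Matrix.blockDiagonal'_smul]
  rfl

lemma scaledSum_two (N : ℕ) {m : ℕ} (d n : Fin m → ℕ) :
    scaledSum N d n 2 = realDiag fun x => (1 / N : ℝ) * magnetic (d x.1.1) x.2 := by
  ext ⟨p, i⟩ ⟨q, j⟩
  rw [scaledSum, Matrix.smul_apply, Matrix.blockDiagonal'_apply, realDiag]
  by_cases h : p = q
  · subst h
    by_cases hij : i = j
    · subst hij; simp [irrep, irrepThree]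
    · simp [irrep, irrepThree, hij]
  · simp [h]

/-- The square of the weight of a raising matrix, in terms of the spin `d / 2` and the position
`y`, counted from the middle of the chain. -/
noncomputable def weightSq (d : ℕ) (y : ℤ) : ℝ :=
  ((d : ℝ) - (y + ((d + 1) / 2 : ℕ))) * (y + ((d + 1) / 2 : ℕ) + 1)

/-- Chains of integer and half-integer spin share integer positions, at the price of an offset of 0
or 1/2 from the magnetic number. -/
lemma half_succ_bounds (d : ℕ) :
    (d : ℝ) / 2 ≤ ((d + 1) / 2 : ℕ) ∧ (((d + 1) / 2 : ℕ) : ℝ) ≤ (d : ℝ) / 2 + 1 / 2 := by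
  have h1 : d ≤ 2 * ((d + 1) / 2) := by omega
  have h2 : 2 * ((d + 1) / 2) ≤ d + 1 := by omega
  have h1' : (d : ℝ) ≤ 2 * ((d + 1) / 2 : ℕ) := by exact_mod_cast h1
  have h2' : 2 * (((d + 1) / 2 : ℕ) : ℝ) ≤ d + 1 := by exact_mod_cast h2
  constructor <;> linarith

lemma weightSq_le {d N : ℕ} {y : ℤ} (hd : d ≤ N) : weightSq d y ≤ ((N + 1) / 2 : ℝ) ^ 2 := by
  have : (d : ℝ) ≤ N := by exact_mod_cast hd
  have h0 : (0 : ℝ) ≤ d := d.cast_nonneg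
  unfold weightSq
  nlinarith [sq_nonneg ((d : ℝ) - (y + ((d + 1) / 2 : ℕ)) - (y + ((d + 1) / 2 : ℕ) + 1))]

/-- The squared weight is (λ + 1/2)² - (μ + 1/2)². Each square changes by the change of its base
times a sum of bases, which is at most N + 1. The extra 1/2 is the parity offset of μ. -/
lemma abs_weightSq_sub_le {d d' N : ℕ} {y y' : ℤ} {L : ℝ} (hd : d ≤ N) (hd' : d' ≤ N)
    (h1 : -(((d + 1) / 2 : ℕ) : ℤ) ≤ y) (h2 : y ≤ (d / 2 : ℕ))
    (h1' : -(((d' + 1) / 2 : ℕ) : ℤ) ≤ y') (h2' : y' ≤ (d' / 2 : ℕ))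
    (h : |(d : ℝ) - d'| / 2 + |(y : ℝ) - y'| ≤ 2 * L) :
    |weightSq d y - weightSq d' y'| ≤ (2 * L + 1 / 2) * (N + 1) := by
  obtain ⟨b1, b2⟩ := half_succ_bounds d
  obtain ⟨b1', b2'⟩ := half_succ_bounds d'
  have e : (d / 2) + (d + 1) / 2 = d := by omega
  have e' : (d' / 2) + (d' + 1) / 2 = d' := by omega
  have e2 : ((d / 2 : ℕ) : ℝ) + ((d + 1) / 2 : ℕ) = d := by exact_mod_cast e
  have e2' : ((d' / 2 : ℕ) : ℝ) + ((d' + 1) / 2 : ℕ) = d' := by exact_mod_cast e'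
  have r1 : -(((d + 1) / 2 : ℕ) : ℝ) ≤ y := by exact_mod_cast h1
  have r1' : -(((d' + 1) / 2 : ℕ) : ℝ) ≤ y' := by exact_mod_cast h1'
  have r2 : (y : ℝ) ≤ ((d / 2 : ℕ) : ℝ) := by
    rw [← Int.cast_natCast (d / 2)]; exact Int.cast_le.mpr h2
  have r2' : (y' : ℝ) ≤ ((d' / 2 : ℕ) : ℝ) := by
    rw [← Int.cast_natCast (d' / 2)]; exact Int.cast_le.mpr h2'
  have hdN : (d : ℝ) ≤ N := by exact_mod_cast hd
  have hdN' : (d' : ℝ) ≤ N := by exact_mod_cast hd'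
  have hd0 : (0 : ℝ) ≤ d := d.cast_nonneg
  have hd0' : (0 : ℝ) ≤ d' := d'.cast_nonneg
  unfold weightSq
  generalize (((d + 1) / 2 : ℕ) : ℝ) = p at *
  generalize (((d' + 1) / 2 : ℕ) : ℝ) = p' at *
  generalize ((d / 2 : ℕ) : ℝ) = q at *
  generalize ((d' / 2 : ℕ) : ℝ) = q' at *
  generalize (y : ℝ) = u at *
  generalize (y' : ℝ) = u' at *
  generalize (d : ℝ) = D at *
  generalize (d' : ℝ) = D' at *
  have key : (D - (u + p)) * (u + p + 1) - (D' - (u' + p')) * (u' + p' + 1)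
      = (D - D') / 2 * ((D + D') / 2 + 1)
        - ((u + p - D / 2) - (u' + p' - D' / 2)) * (u + p - D / 2 + (u' + p' - D' / 2) + 1) := by
    ring
  have hN0 : (0 : ℝ) ≤ N + 1 := by positivity
  have t1 : |(D - D') / 2 * ((D + D') / 2 + 1)| ≤ |D - D'| / 2 * (N + 1) := by
    rw [abs_mul, abs_div, abs_of_pos (show (0 : ℝ) < 2 by norm_num)]
    refine mul_le_mul_of_nonneg_left ?_ (by positivity)
    rw [abs_of_nonneg (by linarith)]; linarith
  have t2 : |((u + p - D / 2) - (u' + p' - D' / 2)) * (u + p - D / 2 + (u' + p' - D' / 2) + 1)|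
      ≤ (|u - u'| + 1 / 2) * (N + 1) := by
    rw [abs_mul]
    refine mul_le_mul ?_ ?_ (abs_nonneg _) (by positivity)
    · have := abs_le.mp (le_refl |u - u'|)
      rw [abs_le]; constructor <;> linarith
    · rw [abs_le]; constructor <;> linarith
  rw [key]
  refine (abs_sub _ _).trans ((add_le_add t1 t2).trans ?_)
  rw [← add_mul]
  exact mul_le_mul_of_nonneg_right (by linarith) hN0

/-- The exponent 1/2 suffices, as √(L/N) is below N^{-1/7}, and no lower bound on the weights is
needed. -/
lemma abs_sqrt_sub_sqrt_le (a b : ℝ) : |√a - √b| ≤ √|a - b| := by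
  have key : ∀ a b : ℝ, b ≤ a → √a - √b ≤ √(a - b) := by
    intro a b hab
    have h1 := Real.sqrt_nonneg (a - b)
    have h2 := Real.sqrt_nonneg b
    rcases le_total 0 b with hb | hb
    · have : √a ≤ √(a - b) + √b := by
        rw [Real.sqrt_le_left (by positivity)]
        nlinarith [Real.sq_sqrt hb, Real.sq_sqrt (sub_nonneg.mpr hab)]
      linarith
    · rw [Real.sqrt_eq_zero_of_nonpos hb, sub_zero]
      exact Real.sqrt_le_sqrt (by linarith)
  rcases le_total b a with h | h
  · rw [abs_of_nonneg (sub_nonneg.mpr (Real.sqrt_le_sqrt h)), abs_of_nonneg (sub_nonneg.mpr h)]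
    exact key a b h
  · rw [abs_sub_comm, abs_sub_comm a,
      abs_of_nonneg (sub_nonneg.mpr (Real.sqrt_le_sqrt h)), abs_of_nonneg (sub_nonneg.mpr h)]
    exact key b a h

/-- The coordinates of a basis vector: summand, copy, and position relative to the middle. -/
def siteCoord {m : ℕ} (d n : Fin m → ℕ) (x : SumIndex d n) : ℤ × ℤ × ℤ :=
  ((x.1.1 : ℕ), (x.1.2 : ℕ), ((x.2 : ℕ) : ℤ) - ((d x.1.1 + 1) / 2 : ℕ))

lemma siteCoord_injective {m : ℕ} (d n : Fin m → ℕ) : Function.Injective (siteCoord d n) := by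
  rintro ⟨⟨r, a⟩, i⟩ ⟨⟨r', a'⟩, i'⟩ h
  simp only [siteCoord, Prod.mk.injEq, Nat.cast_inj] at h
  obtain ⟨h1, h2, h3⟩ := h
  obtain rfl := Fin.ext h1
  obtain rfl := Fin.ext h2
  obtain rfl : i = i' := Fin.ext (by omega)
  rfl

lemma siteCoord_bounds {m : ℕ} (d n : Fin m → ℕ) (x : SumIndex d n) :
    -(((d x.1.1 + 1) / 2 : ℕ) : ℤ) ≤ (siteCoord d n x).2.2 ∧
      (siteCoord d n x).2.2 ≤ (d x.1.1 / 2 : ℕ) := by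
  have := x.2.isLt
  simp only [siteCoord]
  omega

lemma exists_siteCoord {m : ℕ} (d n : Fin m → ℕ) {r : Fin m} {a : ℕ} (ha : a < n r) {y : ℤ}
    (h1 : -(((d r + 1) / 2 : ℕ) : ℤ) ≤ y) (h2 : y ≤ (d r / 2 : ℕ)) :
    ∃ x : SumIndex d n, x.1.1 = r ∧ siteCoord d n x = (((r : ℕ) : ℤ), (a : ℤ), y) := by
  refine ⟨⟨⟨r, ⟨a, ha⟩⟩, ⟨(y + ((d r + 1) / 2 : ℕ)).toNat, by dsimp only; omega⟩⟩, rfl, ?_⟩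
  simp only [siteCoord, Prod.mk.injEq, true_and]
  omega

lemma siteWeight_eq (N : ℕ) {m : ℕ} (d n : Fin m → ℕ) (x : SumIndex d n) :
    siteWeight N d n x = √(weightSq (d x.1.1) (siteCoord d n x).2.2) / N := by
  unfold siteWeight spinWeight weightSq siteCoord magnetic spin
  congr 2
  simp only [Int.cast_sub, Int.cast_natCast]
  ring

lemma siteCoord_siteSucc {m : ℕ} (d n : Fin m → ℕ) (x : SumIndex d n)
    (h : ∃ x', siteCoord d n x' = ExchangeData.succ (siteCoord d n x)) :
    siteCoord d n (siteSucc d n x) = ExchangeData.succ (siteCoord d n x) := by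
  obtain ⟨⟨⟨r', a'⟩, i'⟩, h⟩ := h
  obtain ⟨⟨r, a⟩, i⟩ := x
  simp only [siteCoord, ExchangeData.succ, Prod.mk.injEq, Nat.cast_inj] at h
  obtain ⟨h1, h2, h3⟩ := h
  obtain rfl := Fin.ext h1
  have hi : (i : ℕ) < d r' := by have := i'.isLt; dsimp only at *; omega
  have hrot : ((finRotate (d r' + 1) i : Fin (d r' + 1)) : ℕ) = i + 1 := by
    rw [coe_finRotate_of_ne_last]
    intro h; rw [h] at hi; simp at hi
  have : siteSucc d n ⟨⟨r', a⟩, i⟩ = ⟨⟨r', a⟩, finRotate (d r' + 1) i⟩ := rfl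
  rw [this]
  simp only [siteCoord, ExchangeData.succ, Prod.mk.injEq, true_and, hrot]
  omega

lemma siteWeight_bounds {N : ℕ} (hN : 1 ≤ N) {m : ℕ} {d n : Fin m → ℕ} (hd : ∀ r, d r ≤ N)
    (x : SumIndex d n) : |siteWeight N d n x| ≤ (N + 1) / (2 * N) := by
  have hN' : (0 : ℝ) < N := by exact_mod_cast hN
  rw [siteWeight_eq, abs_of_nonneg (by positivity), div_le_div_iff₀ hN' (by positivity)]
  have : √(weightSq (d x.1.1) (siteCoord d n x).2.2) ≤ (N + 1) / 2 := by
    rw [Real.sqrt_le_left (by positivity)]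
    exact weightSq_le (hd _)
  nlinarith

lemma norm_scaledPlus_le {N : ℕ} (hN : 1 ≤ N) {m : ℕ} {d n : Fin m → ℕ} (hd : ∀ r, d r ≤ N) :
    ‖scaledPlus N d n‖ ≤ (N + 1) / (2 * N) := by
  refine (Matrix.l2_opNorm_mul _ _).trans
    ((mul_le_of_le_one_left (norm_nonneg _) (norm_shiftMatrix_le _)).trans ?_)
  exact norm_realDiag_le (by positivity) (siteWeight_bounds hN hd)

/-! ### Families of spins: ranks of chains, good corners, and small weights at the bad ones. -/

open Classical in
/-- The number of the chains `(r + q L, a)`, `q ≥ 0`, among the summands and their copies. -/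
noncomputable def chainRank {m : ℕ} (n : Fin m → ℕ) (L : ℕ) (r a : ℤ) : ℕ :=
  ((Finset.range m).filter fun q : ℕ =>
    ∃ r' : Fin m, ((r' : ℕ) : ℤ) = r + q * L ∧ a < n r').card

lemma chainRank_step {m : ℕ} {n : Fin m → ℕ} {L : ℕ} (hL : 0 < L) {r : Fin m} {a : ℤ}
    (ha : a < n r) : chainRank n L r a = chainRank n L (r + L) a + 1 := by
  classical
  unfold chainRank
  have : ((Finset.range m).filter fun q : ℕ =>
      ∃ r' : Fin m, ((r' : ℕ) : ℤ) = ((r : ℕ) : ℤ) + q * L ∧ a < n r')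
      = insert 0 ((((Finset.range m).filter fun q : ℕ =>
      ∃ r' : Fin m, ((r' : ℕ) : ℤ) = ((r : ℕ) : ℤ) + L + q * L ∧ a < n r')).image Nat.succ) := by
    ext q
    simp only [Finset.mem_filter, Finset.mem_range, Finset.mem_insert, Finset.mem_image]
    constructor
    · rintro ⟨hq, r', h1, h2⟩
      rcases q with _ | q
      · exact Or.inl rfl
      · refine Or.inr ⟨q, ⟨by omega, r', ?_, h2⟩, rfl⟩
        rw [h1]; push_cast; ring
    · rintro (rfl | ⟨q, ⟨hq, r', h1, h2⟩, rfl⟩)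
      · have := r.isLt
        exact ⟨by omega, r, by simp, ha⟩
      · refine ⟨?_, r', ?_, h2⟩
        · have h3 := r'.isLt
          have h4 : (q : ℤ) + 1 ≤ (q + 1) * L := by
            have : (1 : ℤ) ≤ L := by exact_mod_cast hL
            nlinarith
          have h5 : ((r' : ℕ) : ℤ) < m := by exact_mod_cast h3
          have h6 : (0 : ℤ) ≤ ((r : ℕ) : ℤ) := by positivity
          have : (q : ℤ) + 1 < m := by linarith
          exact_mod_cast this
        · rw [h1]; push_cast; ring
  rw [this, Finset.card_insert_of_notMem (by simp), Finset.card_image_of_injective _ Nat.succ_injective]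

/-- The hypotheses on the spins and multiplicities, for windows of length `ℓ`. -/
structure SpinFamily (N : ℕ) {m : ℕ} (d n : Fin m → ℕ) (iStar : Fin m) (L ℓ : ℕ) : Prop where
  step : ∃ σ : ℕ, (σ = 1 ∨ σ = 2) ∧ ∀ r r' : Fin m, (r : ℕ) ≤ r' → d r' = d r + σ * (r' - r)
  le : ∀ r, d r ≤ N
  star : spin (d iStar) ≤ Real.sqrt (N : ℝ) / 2 + 1
  mult : ∀ i j : Fin m, iStar ≤ i → (j : ℕ) = (i : ℕ) + L → n j ≤ n i
  window_pos : 0 < ℓ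
  le_length : 8 ≤ L
  length_le : L ≤ N
  fits : 4 * (N / L + 1) * ℓ ≤ L

namespace SpinFamily

variable {N m : ℕ} {d n : Fin m → ℕ} {iStar : Fin m} {L ℓ : ℕ}

lemma mono (h : SpinFamily N d n iStar L ℓ) {r r' : Fin m} (hr : (r : ℕ) ≤ r') :
    d r ≤ d r' ∧ (d r' : ℤ) ≤ d r + 2 * ((r' : ℕ) - (r : ℕ) : ℤ) ∧
      ((r' : ℕ) - (r : ℕ) : ℤ) ≤ (d r' : ℤ) - d r := by
  obtain ⟨σ, hσ, h1⟩ := h.step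
  have := h1 r r' hr
  rcases hσ with rfl | rfl <;> omega

/-- Twice the spin grows by at least 1 per summand and stays at most N, so qL ≤ N. -/
lemma rank_le (h : SpinFamily N d n iStar L ℓ) (r : Fin m) (a : ℤ) :
    chainRank n L r a ≤ N / L + 1 := by
  classical
  have hL : 0 < L := by have := h.le_length; omega
  unfold chainRank
  calc _ ≤ (Finset.range (N / L + 1)).card := Finset.card_le_card ?_
    _ = _ := Finset.card_range _
  intro q hq
  simp only [Finset.mem_filter, Finset.mem_range] at hq ⊢
  obtain ⟨-, r', h1, -⟩ := hq
  rw [Nat.lt_succ_iff, Nat.le_div_iff_mul_le hL]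
  have h1' : (r' : ℕ) = r + q * L := by exact_mod_cast h1
  have h2 := h.mono (r := r) (r' := r') (by omega)
  have h3 := h.le r'
  zify at *
  linarith [h2.2.2]

lemma mult_iterate (h : SpinFamily N d n iStar L ℓ) (q : ℕ) (i j : Fin m) (hi : iStar ≤ i)
    (hj : (j : ℕ) = i + q * L) : n j ≤ n i := by
  induction q generalizing j with
  | zero =>
    have : j = i := Fin.ext (by simpa using hj)
    rw [this]
  | succ q ih =>
    have hlt := j.isLt
    have e : (q + 1) * L = q * L + L := by ring
    have h1 := ih ⟨i + q * L, by omega⟩ rfl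
    refine le_trans (h.mult ⟨i + q * L, by omega⟩ j ?_ (by simp only; omega)) h1
    exact Fin.le_def.mpr (by have := Fin.le_def.mp hi; simp only; omega)

/-- The exchanges for a family of spins. -/
noncomputable def exchangeData (h : SpinFamily N d n iStar L ℓ) : ExchangeData where
  L := L
  ℓ := ℓ
  g := fun r a => chainRank n L r a
  Site := fun p => ((iStar : ℕ) : ℤ) ≤ p.1 ∧ ∃ x, siteCoord d n x = p
  -- The chain `r₀` is the shorter of the two that meet at the corner; if the two adjacent columns
  -- lie in it, they lie in both.
  Good := fun v => ∃ r₁ r₀ : Fin m, ((r₁ : ℕ) : ℤ) = v.1 ∧ ((r₀ : ℕ) : ℤ) + L = v.1 ∧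
    iStar ≤ r₀ ∧ 0 ≤ v.2.1 ∧ v.2.1 < n r₁ ∧
    -(((d r₀ + 1) / 2 : ℕ) : ℤ) ≤ (v.2.2 - 1) * L ∧ (v.2.2 + 1) * L ≤ (d r₀ / 2 : ℕ)
  window_pos := by exact_mod_cast h.window_pos
  g_pos := by
    rintro r a y ⟨-, x, hx⟩
    have hL : 0 < L := by have := h.le_length; omega
    simp only [siteCoord, Prod.mk.injEq] at hx
    obtain ⟨rfl, rfl, -⟩ := hx
    rw [chainRank_step hL (by exact_mod_cast x.1.2.isLt)]
    push_cast; omega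
  fits := by
    rintro r a y ⟨-, x, hx⟩
    simp only [siteCoord, Prod.mk.injEq] at hx
    obtain ⟨rfl, rfl, -⟩ := hx
    have h1 := h.rank_le x.1.1 ((x.1.2 : ℕ) : ℤ)
    have h2 := h.fits
    have : 4 * chainRank n L ((x.1.1 : ℕ) : ℤ) ((x.1.2 : ℕ) : ℤ) * ℓ ≤ L :=
      le_trans (by gcongr) h2
    exact_mod_cast this
  g_step := by
    rintro r a y y' ⟨-, x, hx⟩ -
    have hL : 0 < L := by have := h.le_length; omega
    simp only [siteCoord, Prod.mk.injEq] at hx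
    obtain ⟨rfl, rfl, -⟩ := hx
    rw [chainRank_step hL (by exact_mod_cast x.1.2.isLt)]
    push_cast; rfl
  site_of_good := by
    rintro r a k y ⟨r₁, r₀, h1, h2, h3, h4, h5, h6, h7⟩ hy1 hy2
    dsimp only at *
    have h3' := Fin.le_def.mp h3
    have hm := h.mono (r := r₀) (r' := r₁) (by omega)
    obtain ⟨b, rfl⟩ := Int.eq_ofNat_of_zero_le h4
    have hb : b < n r₁ := by exact_mod_cast h5
    have hn := h.mult r₀ r₁ h3 (by omega)
    obtain ⟨x, -, hx⟩ := exists_siteCoord d n hb (y := y) (by omega) (by omega)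
    obtain ⟨x', -, hx'⟩ := exists_siteCoord d n (r := r₀) (a := b) (by omega) (y := y)
      (by omega) (by omega)
    refine ⟨⟨by omega, x, by rw [hx, h1]⟩, ⟨by omega, x', ?_⟩⟩
    rw [hx', ← h2, add_sub_cancel_right]

lemma weight_diff {F F' B : ℝ} (hN : 1 ≤ N) (h : |F - F'| ≤ B) :
    |√F / N - √F' / N| ≤ √B / N := by
  have : (0 : ℝ) < N := by exact_mod_cast hN
  rw [← sub_div, abs_div, abs_of_pos this]
  gcongr
  exact (abs_sqrt_sub_sqrt_le _ _).trans (Real.sqrt_le_sqrt h)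

lemma weightSq_le_of_small (h : SpinFamily N d n iStar L ℓ) {r : Fin m}
    (hr : (r : ℕ) ≤ iStar + L) (y : ℤ) :
    weightSq (d r) y ≤ (3 * L + 2) * (N + 1) := by
  have h8 : (8 : ℝ) ≤ L := by exact_mod_cast h.le_length
  have hLN : (L : ℝ) ≤ N := by exact_mod_cast h.length_le
  have hs := h.star
  have hd : (d r : ℝ) ≤ d iStar + 2 * L := by
    rcases le_total (r : ℕ) iStar with h1 | h1
    · have := (h.mono h1).1
      have : (d r : ℝ) ≤ d iStar := by exact_mod_cast this
      linarith
    · have := (h.mono h1).2.1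
      have : (d r : ℤ) ≤ d iStar + 2 * L := by omega
      exact_mod_cast this
  have hsq : 1 ≤ √(N : ℝ) := by
    rw [Real.one_le_sqrt]; linarith
  have hss := Real.sq_sqrt (show (0 : ℝ) ≤ N by linarith)
  have h0 : (0 : ℝ) ≤ d r := Nat.cast_nonneg _
  have hb : ((d r : ℝ) + 1) / 2 ≤ 2 * √(N : ℝ) + L := by
    unfold spin at hs; linarith
  have h1 : weightSq (d r) y ≤ (((d r : ℝ) + 1) / 2) ^ 2 := weightSq_le le_rfl
  have h2 : (((d r : ℝ) + 1) / 2) ^ 2 ≤ (2 * √(N : ℝ) + L) ^ 2 := by gcongr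
  -- By the hint, (2√N + L)² ≤ 8N + 2L², and this is at most 3LN since 8 ≤ L ≤ N.
  nlinarith [sq_nonneg (2 * √(N : ℝ) - L)]

/-- Where a corner is not good, the weights are small. -/
lemma weightSq_le_of_bad (h : SpinFamily N d n iStar L ℓ) (x : SumIndex d n)
    (hx : ¬ (h.exchangeData.Site (siteCoord d n x) ∧
      h.exchangeData.Good (h.exchangeData.vertex (siteCoord d n x)))) :
    weightSq (d x.1.1) (siteCoord d n x).2.2 ≤ (3 * L + 2) * (N + 1) := by
  by_cases hsmall : (x.1.1 : ℕ) ≤ iStar + L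
  · exact h.weightSq_le_of_small hsmall _
  have hsite : h.exchangeData.Site (siteCoord d n x) := ⟨by simp only [siteCoord]; omega, x, rfl⟩
  have hL : (0 : ℤ) < L := by exact_mod_cast (by have := h.le_length; omega)
  have hbad : ¬ h.exchangeData.Good (h.exchangeData.vertex (siteCoord d n x)) :=
    fun hg => hx ⟨hsite, hg⟩
  obtain ⟨c1, c2⟩ := siteCoord_bounds d n x
  set y := (siteCoord d n x).2.2 with hy
  obtain ⟨l1, l2⟩ := ExchangeData.div_mul_le (D := h.exchangeData) y hL
  change y / (L : ℤ) * L ≤ y at l1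
  change y < (y / (L : ℤ) + 1) * L at l2
  set r := x.1.1 with hr
  have hv2 : (h.exchangeData.vertex (siteCoord d n x)).2.1 = ((x.1.2 : ℕ) : ℤ) := rfl
  have hv3 : (h.exchangeData.vertex (siteCoord d n x)).2.2 = y / L ∨
      (h.exchangeData.vertex (siteCoord d n x)).2.2 = y / L + 1 := by
    simp only [ExchangeData.vertex]
    split_ifs
    · right; rfl
    · left; simp only [add_zero]; rfl
  have hv1 : ∃ r₁ r₀ : Fin m, ((r₁ : ℕ) : ℤ) = (h.exchangeData.vertex (siteCoord d n x)).1 ∧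
      ((r₀ : ℕ) : ℤ) + L = (h.exchangeData.vertex (siteCoord d n x)).1 ∧ (x.1.2 : ℕ) < n r₁ ∧
      (r₀ : ℕ) ≤ r ∧ (r : ℕ) ≤ r₀ + L ∧ (iStar : ℕ) ≤ r₀ := by
    by_cases hk : h.exchangeData.kind (siteCoord d n x) = 2 ∨
        h.exchangeData.kind (siteCoord d n x) = 3
    · have hv : (h.exchangeData.vertex (siteCoord d n x)).1 = ((r : ℕ) : ℤ) + L := by
        simp only [ExchangeData.vertex, hk, if_true]; rfl
      have hw := ExchangeData.win_lt_of_kind_ne (D := h.exchangeData)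
        (r := (siteCoord d n x).1) (a := (siteCoord d n x).2.1) (y := y) (by
          rcases hk with hk | hk <;> (change h.exchangeData.kind (siteCoord d n x) ≠ 4; omega))
      have hw' : h.exchangeData.win y % 4 = 2 ∨ h.exchangeData.win y % 4 = 3 := by
        rw [← hw.2]; exact hk
      have hw0 := ExchangeData.win_nonneg (D := h.exchangeData) (y := y) hL
      -- Types 2 and 3 occur only at rank at least 2, so this copy occurs in some higher summand r +
      -- L + qL, and by monotonicity of the multiplicities also in r + L.
      have hg2 : 2 ≤ chainRank n L ((r : ℕ) : ℤ) ((x.1.2 : ℕ) : ℤ) := by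
        have : h.exchangeData.g (siteCoord d n x).1 (siteCoord d n x).2.1
          = (chainRank n L ((r : ℕ) : ℤ) ((x.1.2 : ℕ) : ℤ) : ℤ) := rfl
        omega
      have hg1 : 0 < chainRank n L (((r : ℕ) : ℤ) + L) ((x.1.2 : ℕ) : ℤ) := by
        rw [chainRank_step (by omega) (by exact_mod_cast x.1.2.isLt)] at hg2
        omega
      obtain ⟨q, hq⟩ := Finset.card_pos.mp hg1
      simp only [Finset.mem_filter, Finset.mem_range] at hq
      obtain ⟨-, r', q1, q2⟩ := hq
      have q1' : (r' : ℕ) = r + L + q * L := by exact_mod_cast q1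
      have q2' : (x.1.2 : ℕ) < n r' := by exact_mod_cast q2
      have hlt := r'.isLt
      refine ⟨⟨r + L, by omega⟩, r, by rw [hv]; push_cast; rfl, hv.symm, ?_, le_rfl, by omega,
        by omega⟩
      exact q2'.trans_le (h.mult_iterate q ⟨r + L, by omega⟩ r'
        (Fin.le_def.mpr (by simp only; omega)) q1')
    · have hv : (h.exchangeData.vertex (siteCoord d n x)).1 = ((r : ℕ) : ℤ) := by
        simp only [ExchangeData.vertex, hk, if_false, add_zero]; rfl
      have hlt := r.isLt
      refine ⟨r, ⟨r - L, by omega⟩, hv.symm, ?_, x.1.2.isLt, by simp only; omega, by simp only; omega,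
        by simp only; omega⟩
      rw [hv]; simp only; omega
  obtain ⟨r₁, r₀, e1, e2, e3, e4, e5, e6⟩ := hv1
  have hrange : ¬ (-(((d r₀ + 1) / 2 : ℕ) : ℤ)
        ≤ ((h.exchangeData.vertex (siteCoord d n x)).2.2 - 1) * L ∧
      ((h.exchangeData.vertex (siteCoord d n x)).2.2 + 1) * L ≤ (d r₀ / 2 : ℕ)) := by
    rintro ⟨f1, f2⟩
    exact hbad ⟨r₁, r₀, e1, e2, Fin.le_def.mpr e6, by rw [hv2]; positivity,
      by rw [hv2]; exact_mod_cast e3, f1, f2⟩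
  have hm := h.mono e4
  have hdr := h.le r
  have hdl : (d r : ℤ) ≤ d r₀ + 2 * L := by omega
  -- Both chains exist, so the corner is bad only because its columns leave `r₀`. One of them
  -- contains y, which puts y within 2L of an end of `r₀`, and thus within 3L of an end of its own
  -- chain.
  have hcase : (d r₀ / 2 : ℕ) < y + 2 * L ∨ y - 2 * L < -(((d r₀ + 1) / 2 : ℕ) : ℤ) := by
    by_contra hc
    rw [not_or, not_lt, not_lt] at hc
    apply hrange
    rcases hv3 with hv3 | hv3 <;> rw [hv3] <;> constructor <;> nlinarith
  obtain ⟨b1, b2⟩ := half_succ_bounds (d r)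
  have hdN : (d r : ℝ) ≤ N := by exact_mod_cast hdr
  have hyl : -(((d r + 1) / 2 : ℕ) : ℝ) ≤ y := by exact_mod_cast c1
  have hyu : (y : ℝ) + ((d r + 1) / 2 : ℕ) ≤ d r := by
    have key : ∀ p : ℕ, y + p ≤ (d r : ℤ) → (y : ℝ) + p ≤ d r := fun p hp => by exact_mod_cast hp
    exact key _ (by omega)
  have hL0 : (0 : ℝ) ≤ L := Nat.cast_nonneg _
  unfold weightSq
  rcases hcase with hc | hc
  · have key : ∀ p : ℕ, (d r : ℤ) - (y + p) ≤ 3 * L → (d r : ℝ) - (y + p) ≤ 3 * L :=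
      fun p hp => by exact_mod_cast hp
    have h1 := key ((d r + 1) / 2) (by omega)
    have h2 : (y : ℝ) + ((d r + 1) / 2 : ℕ) + 1 ≤ N + 1 := by linarith
    exact mul_le_mul (by linarith) h2 (by linarith) (by linarith)
  · have key : ∀ p : ℕ, y + p + 1 ≤ 3 * (L : ℤ) + 2 → (y : ℝ) + p + 1 ≤ 3 * L + 2 :=
      fun p hp => by exact_mod_cast hp
    have h1 := key ((d r + 1) / 2) (by omega)
    have h2 : (d r : ℝ) - (y + ((d r + 1) / 2 : ℕ)) ≤ N + 1 := by linarith
    rw [mul_comm]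
    exact mul_le_mul h1 h2 (by linarith) (by linarith)

open Classical in
/-- The weight at a corner. -/
noncomputable def cornerWeight (N : ℕ) {m : ℕ} (d : Fin m → ℕ) (L : ℕ) (v : ℤ × ℤ × ℤ) : ℝ :=
  if hv : ∃ r : Fin m, ((r : ℕ) : ℤ) = v.1 then √(weightSq (d hv.choose) (v.2.2 * L)) / N else 0

lemma cornerWeight_eq {r : Fin m} {v : ℤ × ℤ × ℤ} (hv : ((r : ℕ) : ℤ) = v.1) :
    cornerWeight N d L v = √(weightSq (d r) (v.2.2 * L)) / N := by
  unfold cornerWeight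
  have hex : ∃ r : Fin m, ((r : ℕ) : ℤ) = v.1 := ⟨r, hv⟩
  rw [dif_pos hex]
  have : hex.choose = r := Fin.ext (by have := hex.choose_spec; omega)
  rw [this]

/-- The first error term is the variation of the weights around a corner, and the second is the
rotation angle times the largest weight. -/
theorem exists_normal (h : SpinFamily N d n iStar L ℓ) :
    ∃ W A : Matrix (SumIndex d n) (SumIndex d n) ℂ, W * Wᴴ = Wᴴ * W ∧ A.IsHermitian ∧
      W * A = A * W ∧ IsRealMatrix W ∧ IsRealMatrix A ∧
      ‖W - scaledPlus N d n‖ ≤ 2 * (√((3 * L + 2) * (N + 1)) / N)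
        + Real.pi / (2 * ℓ) * ((N + 1) / (2 * N)) ∧
      ‖A - scaledSum N d n 2‖ ≤ 1 / N * L := by
  have h8 := h.le_length
  have hN : 1 ≤ N := by have := h.length_le; omega
  have hN' : (0 : ℝ) < N := by exact_mod_cast hN
  have hL : (0 : ℤ) < L := by exact_mod_cast (by omega)
  have hLr : (8 : ℝ) ≤ L := by exact_mod_cast h8
  have hB : ∀ {F F' : ℝ}, |F - F'| ≤ (2 * L + 1 / 2) * (N + 1) →
      |√F / N - √F' / N| ≤ √((3 * L + 2) * (N + 1)) / N := by
    intro F F' hF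
    refine weight_diff hN (hF.trans ?_)
    gcongr <;> linarith
  have := ExchangeData.exists_normal h.exchangeData (siteCoord_injective d n)
    (fun p hp => hp.2) (siteSucc d n)
    (fun x _ hx => siteCoord_siteSucc d n x hx.2) hL
    (ω := cornerWeight N d L) (w₀ := siteWeight N d n)
    (ν := fun x => magnetic (d x.1.1) x.2) (κ := 1 / (N : ℝ))
    (ε := √((3 * L + 2) * (N + 1)) / N) (K := (N + 1) / (2 * N)) (by positivity) (by positivity)
    ?_ ?_ ?_ (siteWeight_bounds hN h.le) (by positivity) ?_
  · rw [scaledSum_two]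
    exact this
  · rintro x - hg
    obtain ⟨r₁, r₀, g1, g2, g3, -, -, g6, g7⟩ := hg
    obtain ⟨c1, c2⟩ := siteCoord_bounds d n x
    rw [cornerWeight_eq g1, siteWeight_eq]
    apply hB
    set y := (siteCoord d n x).2.2 with hy
    have hm := h.mono (r := r₀) (r' := r₁) (by omega)
    set k := (h.exchangeData.vertex (siteCoord d n x)).2.2 with hk
    have hk' : k = y / L ∨ k = y / L + 1 := by
      rw [hk]
      simp only [ExchangeData.vertex]
      split_ifs
      · right; rfl
      · left; simp only [add_zero]; rfl
    obtain ⟨l1, l2⟩ := ExchangeData.div_mul_le (D := h.exchangeData) y hL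
    change y / (L : ℤ) * L ≤ y at l1
    change y < (y / (L : ℤ) + 1) * L at l2
    rw [sub_one_mul] at g6
    rw [add_one_mul] at g7
    refine abs_weightSq_sub_le (h.le _) (h.le _) ?_ ?_ c1 c2 ?_
    · generalize k * (L : ℤ) = t at *
      omega
    · generalize k * (L : ℤ) = t at *
      omega
    · have hr : (h.exchangeData.vertex (siteCoord d n x)).1 = ((x.1.1 : ℕ) : ℤ) ∨
          (h.exchangeData.vertex (siteCoord d n x)).1 = ((x.1.1 : ℕ) : ℤ) + L := by
        simp only [ExchangeData.vertex]
        split_ifs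
        · right; rfl
        · left; simp only [add_zero]; rfl
      have hd : |(d r₁ : ℝ) - d x.1.1| ≤ 2 * L := by
        have h1 := h.mono (r := x.1.1) (r' := r₁) (by omega)
        have : |(d r₁ : ℤ) - d x.1.1| ≤ 2 * L := by rw [abs_le]; omega
        exact_mod_cast this
      have hyy : |((k * L : ℤ) : ℝ) - y| ≤ L := by
        have : |k * L - y| ≤ L := by
          rw [abs_le]; rcases hk' with hk' | hk' <;> rw [hk'] <;> constructor <;> nlinarith
        exact_mod_cast this
      linarith
  · intro x hx
    rw [siteWeight_eq, abs_of_nonneg (by positivity)]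
    gcongr
    exact h.weightSq_le_of_bad x hx
  · intro x x' hex hx'
    obtain ⟨c1, c2⟩ := siteCoord_bounds d n x
    obtain ⟨c1', c2'⟩ := siteCoord_bounds d n x'
    rw [siteWeight_eq, siteWeight_eq]
    apply hB
    refine abs_weightSq_sub_le (h.le _) (h.le _) c1 c2 c1' c2' ?_
    obtain ⟨r', y', p1, s1, -, -, w1, -, -, -, p2⟩ := ExchangeData.exchanged_cases
      (r := (siteCoord d n x).1) (a := (siteCoord d n x).2.1) (y := (siteCoord d n x).2.2) hex
    have hx'' : siteCoord d n x' = (r', (siteCoord d n x).2.1, y') := hx'.trans p1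
    have hr' : (((x'.1.1 : Fin m) : ℕ) : ℤ) = r' := congrArg Prod.fst hx''
    have hy' : (siteCoord d n x').2.2 = y' := congrArg (fun p => p.2.2) hx''
    have hw0 := ExchangeData.g_pos _ s1
    have hf := ExchangeData.fits _ s1
    change 4 * h.exchangeData.g (siteCoord d n x).1 (siteCoord d n x).2.1 * (ℓ : ℤ) ≤ (L : ℤ) at hf
    have hℓ : 2 * (ℓ : ℤ) ≤ L := by nlinarith [h.window_pos]
    have hcond : |(d x.1.1 : ℤ) - d x'.1.1| + 2 * |(siteCoord d n x).2.2 - (siteCoord d n x').2.2|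
        ≤ 4 * L := by
      have hrr : (siteCoord d n x).1 = ((x.1.1 : ℕ) : ℤ) := rfl
      rw [hy']
      have eL : h.exchangeData.L = L := rfl
      have eℓ : h.exchangeData.ℓ = ℓ := rfl
      rw [eL, eℓ, hrr] at p2
      rcases p2 with ⟨-, -, q1, q2, -⟩ | ⟨-, -, q1, q2, -⟩ | ⟨-, -, q1, q2, -⟩ | ⟨-, -, q1, q2, -⟩
      · have h1 := h.mono (r := x'.1.1) (r' := x.1.1) (by omega)
        have a1 : |(d x.1.1 : ℤ) - d x'.1.1| ≤ 2 * L := by rw [abs_le]; omega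
        have a2 : |(siteCoord d n x).2.2 - y'| ≤ L := by rw [abs_le]; omega
        omega
      · have h1 : x.1.1 = x'.1.1 := Fin.ext (by omega)
        have a2 : |(siteCoord d n x).2.2 - y'| ≤ 2 * L := by rw [abs_le]; omega
        rw [h1, sub_self, abs_zero]
        omega
      · have h1 := h.mono (r := x.1.1) (r' := x'.1.1) (by omega)
        have a1 : |(d x.1.1 : ℤ) - d x'.1.1| ≤ 2 * L := by rw [abs_le]; omega
        have a2 : |(siteCoord d n x).2.2 - y'| ≤ L := by rw [abs_le]; omega
        omega
      · have h1 : x.1.1 = x'.1.1 := Fin.ext (by omega)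
        have a2 : |(siteCoord d n x).2.2 - y'| ≤ 2 * L := by rw [abs_le]; omega
        rw [h1, sub_self, abs_zero]
        omega
    have hcond' : |(d x.1.1 : ℝ) - d x'.1.1|
        + 2 * |((siteCoord d n x).2.2 : ℝ) - (siteCoord d n x').2.2| ≤ 4 * L := by
      exact_mod_cast hcond
    linarith
  · intro x
    obtain ⟨l1, l2⟩ := ExchangeData.div_mul_le (D := h.exchangeData) (siteCoord d n x).2.2 hL
    obtain ⟨b1, b2⟩ := half_succ_bounds (d x.1.1)
    have hmag : magnetic (d x.1.1) x.2
        = ((siteCoord d n x).2.2 : ℝ) + (((d x.1.1 + 1) / 2 : ℕ) - (d x.1.1 : ℝ) / 2) := by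
      simp only [magnetic, spin, siteCoord, Int.cast_sub, Int.cast_natCast]
      ring
    set D := h.exchangeData with hD
    have l1' : (((siteCoord d n x).2.2 / D.L : ℤ) : ℝ) * (D.L : ℝ) ≤ (siteCoord d n x).2.2 := by
      exact_mod_cast l1
    have l2' : ((siteCoord d n x).2.2 : ℝ) + 1
        ≤ ((((siteCoord d n x).2.2 / D.L : ℤ) : ℝ) + 1) * (D.L : ℝ) := by
      -- Positions are integers, so y + 1 still fits below the right end of the column; this absorbs
      -- the offset 1/2.
      exact_mod_cast l2
    rw [hmag]
    constructor <;> linarith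

end SpinFamily

/-! ### Choice of the parameters, with x = N^{1/7}, and the numerical constants. -/

lemma exists_step {m : ℕ} {d : Fin m → ℕ}
    (hstep : (∀ r r' : Fin m, (r' : ℕ) = (r : ℕ) + 1 → spin (d r') - spin (d r) = 1) ∨
      (∀ r r' : Fin m, (r' : ℕ) = (r : ℕ) + 1 → spin (d r') - spin (d r) = 1 / 2)) :
    ∃ σ : ℕ, (σ = 1 ∨ σ = 2) ∧ ∀ r r' : Fin m, (r : ℕ) ≤ r' → d r' = d r + σ * (r' - r) := by
  have key : ∀ σ : ℕ, (∀ r r' : Fin m, (r' : ℕ) = (r : ℕ) + 1 → d r' = d r + σ) →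
      ∀ r r' : Fin m, (r : ℕ) ≤ r' → d r' = d r + σ * (r' - r) := by
    intro σ hσ r
    have : ∀ (q : ℕ) (r' : Fin m), (r' : ℕ) = r + q → d r' = d r + σ * q := by
      intro q
      induction q with
      | zero =>
        intro r' hr'
        have : r' = r := Fin.ext (by simpa using hr')
        rw [this, mul_zero, add_zero]
      | succ q ih =>
        intro r' hr'
        have hlt := r'.isLt
        have h1 := ih ⟨r + q, by omega⟩ rfl
        rw [hσ ⟨r + q, by omega⟩ r' (by simp only; omega), h1]
        ring
    intro r' hr'
    exact this _ r' (by omega)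
  rcases hstep with h | h
  · refine ⟨2, Or.inr rfl, key 2 fun r r' hr => ?_⟩
    have h1 := h r r' hr
    unfold spin at h1
    have : (d r' : ℝ) = d r + 2 := by linarith
    exact_mod_cast this
  · refine ⟨1, Or.inl rfl, key 1 fun r r' hr => ?_⟩
    have h1 := h r r' hr
    unfold spin at h1
    have : (d r' : ℝ) = d r + 1 := by linarith
    exact_mod_cast this

lemma natCast_le_of_last {N m : ℕ} {d : Fin m → ℕ} {σ : ℕ}
    (hσ : ∀ r r' : Fin m, (r : ℕ) ≤ r' → d r' = d r + σ * (r' - r))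
    (hlast : ∀ r : Fin m, (r : ℕ) + 1 = m → spin (d r) ≤ (N : ℝ) / 2) (r : Fin m) : d r ≤ N := by
  have hlt := r.isLt
  have h1 := hlast ⟨m - 1, by omega⟩ (by simp only; omega)
  have h2 := hσ r ⟨m - 1, by omega⟩ (by simp only; omega)
  unfold spin at h1
  have h3 : (d ⟨m - 1, by omega⟩ : ℝ) ≤ N := by linarith
  have h4 : d ⟨m - 1, by omega⟩ ≤ N := by exact_mod_cast h3
  exact (Nat.le_add_right _ _).trans (h2 ▸ h4)

lemma seventh_root_pow (N : ℕ) (k : ℕ) :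
    ((N : ℝ) ^ ((1 : ℝ) / 7)) ^ k = (N : ℝ) ^ ((k : ℝ) / 7) := by
  rw [← Real.rpow_natCast, ← Real.rpow_mul (Nat.cast_nonneg _)]
  congr 1; ring

lemma seventh_root_inv_pow (N : ℕ) (k : ℕ) :
    (N : ℝ) ^ (-(k : ℝ) / 7) = 1 / ((N : ℝ) ^ ((1 : ℝ) / 7)) ^ k := by
  rw [seventh_root_pow, one_div, ← Real.rpow_neg (Nat.cast_nonneg _), neg_div]

lemma stepLength_bounds (N : ℕ) :
    1.045 * ((N : ℝ) ^ ((1 : ℝ) / 7)) ^ 4 - 1 ≤ stepLength N ∧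
      (stepLength N : ℝ) ≤ 1.045 * ((N : ℝ) ^ ((1 : ℝ) / 7)) ^ 4 := by
  rw [seventh_root_pow]
  unfold stepLength
  push_cast
  constructor
  · linarith [Nat.lt_floor_add_one ((1.045 : ℝ) * (N : ℝ) ^ ((4 : ℝ) / 7))]
  · exact Nat.floor_le (by positivity)

/-- For small `N`, the weights are so small that they may be replaced by zero. -/
lemma half_le_of_small {N : ℕ} {x : ℝ} (hN : 1 ≤ N) (hx0 : 0 < x) (hx : x ^ 7 = N)
    (hsmall : x ≤ 12.5) : ((N : ℝ) + 1) / (2 * N) ≤ 6.286 * (1 / x) := by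
  have hN' : (1 : ℝ) ≤ N := by exact_mod_cast hN
  have e : ((N : ℝ) + 1) / (2 * N) = 1 / 2 + 1 / (2 * N) := by field_simp
  rw [e]
  by_cases h : (200 : ℝ) ≤ N
  · have h1 : 1 / (2 * (N : ℝ)) ≤ 1 / 400 :=
      one_div_le_one_div_of_le (by norm_num) (by linarith)
    have h2 : 1 / 12.5 ≤ 1 / x := one_div_le_one_div_of_le hx0 hsmall
    linarith
  · have h1 : 1 / (2 * (N : ℝ)) ≤ 1 / 2 :=
      one_div_le_one_div_of_le (by norm_num) (by linarith)
    have h3 : x ≤ 5 := by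
      by_contra hc
      have : (5 : ℝ) ^ 7 ≤ x ^ 7 := pow_le_pow_left₀ (by norm_num) (by linarith) 7
      rw [hx] at this
      linarith
    have h2 : 1 / 5 ≤ 1 / x := one_div_le_one_div_of_le hx0 h3
    linarith

lemma error_le_of_large {N L : ℕ} {x ℓ : ℝ} (hx : x ^ 7 = N) (hlarge : 12.5 ≤ x)
    (hL : (L : ℝ) ≤ 1.045 * x ^ 4) (hℓ : 0.19 * x ≤ ℓ) :
    2 * (√((3 * L + 2) * (N + 1)) / N) + Real.pi / (2 * ℓ) * ((N + 1) / (2 * N))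
      ≤ 6.286 * (1 / x) := by
  have hx0 : 0 < x := by linarith
  have p3 : 12.5 ^ 3 ≤ x ^ 3 := pow_le_pow_left₀ (by norm_num) hlarge 3
  have p4 : 12.5 ^ 4 ≤ x ^ 4 := pow_le_pow_left₀ (by norm_num) hlarge 4
  have p7 : 12.5 ^ 7 ≤ x ^ 7 := pow_le_pow_left₀ (by norm_num) hlarge 7
  norm_num at p3 p4 p7
  rw [← hx]
  have hN0 : 0 < x ^ 7 := by positivity
  have h1 : √((3 * L + 2) * (x ^ 7 + 1)) / x ^ 7 ≤ 0.51 * (1 / x) := by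
    rw [div_le_iff₀ hN0]
    have e : 0.51 * (1 / x) * x ^ 7 = 0.51 * x ^ 6 := by field_simp
    rw [e, Real.sqrt_le_left (by positivity)]
    have a1 : (3 * (L : ℝ) + 2) ≤ 3.14 * x ^ 4 := by linarith
    have a2 : x ^ 7 + 1 ≤ 1.0001 * x ^ 7 := by linarith
    calc (3 * (L : ℝ) + 2) * (x ^ 7 + 1) ≤ (3.14 * x ^ 4) * (1.0001 * x ^ 7) := by gcongr
      _ = 3.140314 * x ^ 11 := by ring
      _ ≤ 0.2601 * 12.5 * x ^ 11 := by gcongr; norm_num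
      _ ≤ 0.2601 * x * x ^ 11 := by gcongr
      _ = (0.51 * x ^ 6) ^ 2 := by ring
  have h2 : Real.pi / (2 * ℓ) ≤ 8.3 * (1 / x) := by
    rw [mul_one_div, div_le_div_iff₀ (by linarith) hx0]
    have := Real.pi_lt_d2
    nlinarith
  have h3 : (x ^ 7 + 1) / (2 * x ^ 7) ≤ 0.51 := by
    rw [div_le_iff₀ (by positivity)]
    linarith
  have hix : 0 < 1 / x := by positivity
  have h4 : Real.pi / (2 * ℓ) * ((x ^ 7 + 1) / (2 * x ^ 7)) ≤ 8.3 * (1 / x) * 0.51 :=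
    mul_le_mul h2 h3 (by positivity) (by positivity)
  linarith

/-- The windows fit because 4 · 0.27 = 1.08 is less than 1.045² ≈ 1.092; the small gap absorbs the
lower-order terms once x ≥ 12.5. -/
lemma fits_of_large {N L ℓ : ℕ} {x : ℝ} (hx : x ^ 7 = N) (hlarge : 12.5 ≤ x)
    (hL1 : 1.045 * x ^ 4 - 1 ≤ L) (hL2 : (L : ℝ) ≤ 1.045 * x ^ 4) (hℓ : (ℓ : ℝ) ≤ 0.27 * x) :
    8 ≤ L ∧ L ≤ N ∧ 4 * (N / L + 1) * ℓ ≤ L := by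
  have hx0 : 0 < x := by linarith
  have p3 : 12.5 ^ 3 ≤ x ^ 3 := pow_le_pow_left₀ (by norm_num) hlarge 3
  have p4 : 12.5 ^ 4 ≤ x ^ 4 := pow_le_pow_left₀ (by norm_num) hlarge 4
  norm_num at p3 p4
  have hL8 : (8 : ℝ) ≤ L := by linarith
  have hLpos : (0 : ℝ) < L := by linarith
  refine ⟨by exact_mod_cast hL8, ?_, ?_⟩
  · have : (L : ℝ) ≤ N := by
      rw [← hx]
      have : x ^ 7 = x ^ 3 * x ^ 4 := by ring
      rw [this]
      nlinarith
    exact_mod_cast this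
  · have hdiv : ((N / L : ℕ) : ℝ) ≤ (N : ℝ) / L := Nat.cast_div_le
    have : 4 * (((N / L : ℕ) : ℝ) + 1) * ℓ ≤ L := by
      calc 4 * (((N / L : ℕ) : ℝ) + 1) * ℓ ≤ 4 * ((N : ℝ) / L + 1) * (0.27 * x) := by gcongr
        _ = (1.08 * x * (x ^ 7 + L)) / L := by rw [hx]; field_simp; ring
        _ ≤ L := by
          rw [div_le_iff₀ hLpos]
          have b1 : 1.08 * x * (x ^ 7 + L) ≤ 1.08 * x ^ 8 + 1.1286 * x ^ 5 := by
            have : 1.08 * x * (x ^ 7 + L) ≤ 1.08 * x * (x ^ 7 + 1.045 * x ^ 4) := by gcongr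
            linarith [this]
          have b2 : (1.045 * x ^ 4 - 1) * (1.045 * x ^ 4 - 1) ≤ L * L :=
            mul_le_mul hL1 hL1 (by linarith) (by linarith)
          have b3 : x ^ 4 ≤ x ^ 5 := by
            have : x ^ 5 = x * x ^ 4 := by ring
            nlinarith
          have b4 : 1953 * x ^ 5 ≤ x ^ 8 := by
            have : x ^ 8 = x ^ 3 * x ^ 5 := by ring
            rw [this]; gcongr; linarith
          have b5 : 0 < x ^ 5 := by positivity
          nlinarith
    exact_mod_cast this

theorem mainTheorem2 (N : ℕ) (hN : 1 ≤ N) (m : ℕ) (d n : Fin m → ℕ) (iStar : Fin m)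
    (hstep : (∀ r r' : Fin m, (r' : ℕ) = (r : ℕ) + 1 → spin (d r') - spin (d r) = 1) ∨
      (∀ r r' : Fin m, (r' : ℕ) = (r : ℕ) + 1 → spin (d r') - spin (d r) = 1 / 2))
    (hstar : spin (d iStar) ≤ Real.sqrt (N : ℝ) / 2 + 1)
    (hlast : ∀ r : Fin m, (r : ℕ) + 1 = m → spin (d r) ≤ (N : ℝ) / 2)
    (hmult : ∀ i j : Fin m, iStar ≤ i → (j : ℕ) = (i : ℕ) + stepLength N → n j ≤ n i) :
    ∃ A₁ A₂ A₃ : Matrix (SumIndex d n) (SumIndex d n) ℂ,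
      A₁.IsHermitian ∧ A₂.IsHermitian ∧ A₃.IsHermitian ∧
      Commute A₁ A₂ ∧ Commute A₁ A₃ ∧ Commute A₂ A₃ ∧
      ‖A₁ - scaledSum N d n 0‖ ≤ 6.286 * (N : ℝ) ^ (-(1 : ℝ) / 7) ∧
      ‖A₂ - scaledSum N d n 1‖ ≤ 6.286 * (N : ℝ) ^ (-(1 : ℝ) / 7) ∧
      ‖A₃ - scaledSum N d n 2‖ ≤ 1.083 * (N : ℝ) ^ (-(3 : ℝ) / 7) ∧
      IsRealMatrix A₁ ∧ IsRealMatrix (Complex.I • A₂) ∧ IsRealMatrix A₃ := by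
  have hN' : (0 : ℝ) < N := by exact_mod_cast hN
  have hinv1 := seventh_root_inv_pow N 1
  have hinv3 := seventh_root_inv_pow N 3
  have hpow7 := seventh_root_pow N 7
  obtain ⟨hL1, hL2⟩ := stepLength_bounds N
  have hx0 : 0 < (N : ℝ) ^ ((1 : ℝ) / 7) := Real.rpow_pos_of_pos hN' _
  set x := (N : ℝ) ^ ((1 : ℝ) / 7) with hxdef
  norm_num at hinv1 hinv3 hpow7
  obtain ⟨σ, hσ, hd⟩ := exists_step hstep
  have hdN := natCast_le_of_last hd hlast
  have e1 : (N : ℝ) ^ (-(1 : ℝ) / 7) = 1 / x := by rw [one_div, ← hinv1]; norm_num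
  have e3 : (N : ℝ) ^ (-(3 : ℝ) / 7) = 1 / x ^ 3 := by rw [one_div, ← hinv3]; norm_num
  rw [e1, e3]
  -- From 12.5 = 1/0.08 on, rounding 0.27 x down leaves at least 0.19 x. Below it, 6.286/x exceeds
  -- 1/2, roughly the norm bound for S(σ₊), so W = 0 will do, with A equal to S(σ₃).
  rcases le_total x 12.5 with hsmall | hlarge
  · refine exists_triple_of_normal (W := 0) (A := scaledSum N d n 2) (S := scaledPlus N d n)
      (by simp) ?_ (by simp) (fun p q => by simp) ?_ (scaledSum_zero N d n) (scaledSum_one N d n)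
      ?_ ?_
    · rw [scaledSum_two]; exact realDiag_conjTranspose _
    · rw [scaledSum_two]; exact isRealMatrix_realDiag _
    · rw [zero_sub, norm_neg]
      exact (norm_scaledPlus_le hN hdN).trans (half_le_of_small hN hx0 hpow7 hsmall)
    · rw [sub_self, norm_zero]; positivity
  · set ℓ := ⌊0.27 * x⌋₊ with hℓdef
    have hℓ1 : (ℓ : ℝ) ≤ 0.27 * x := Nat.floor_le (by positivity)
    have hℓ2 : 0.19 * x ≤ (ℓ : ℝ) := by
      have : 0.27 * x < (ℓ : ℝ) + 1 := Nat.lt_floor_add_one (0.27 * x)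
      linarith
    have hℓ0 : (0 : ℝ) < ℓ := by linarith
    obtain ⟨f1, f2, f3⟩ := fits_of_large hpow7 hlarge hL1 hL2 hℓ1
    have hfam : SpinFamily N d n iStar (stepLength N) ℓ :=
      ⟨⟨σ, hσ, hd⟩, hdN, hstar, hmult, by exact_mod_cast hℓ0, f1, f2, f3⟩
    obtain ⟨W, A, h1, h2, h3, h4, h5, h6, h7⟩ := hfam.exists_normal
    refine exists_triple_of_normal h1 h2 h3 h4 h5 (scaledSum_zero N d n) (scaledSum_one N d n)
      (h6.trans (error_le_of_large hpow7 hlarge hL2 hℓ2)) (h7.trans ?_)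
    rw [← hpow7, one_div_mul_eq_div, mul_one_div, div_le_div_iff₀ (by positivity) (by positivity)]
    calc (stepLength N : ℝ) * x ^ 3 ≤ 1.045 * x ^ 4 * x ^ 3 := by gcongr
      _ = 1.045 * x ^ 7 := by ring
      _ ≤ 1.083 * x ^ 7 := by gcongr; norm_num
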